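/- **Setting.** Let $\mathcal S_1,\mathcal S_2,\mathcal X_1,\mathcal X_2,\mathcal Y$ be finite alphabets. Fix a joint distribution $p(s_1,s_2)$ of the hosts, a channel $p(y\mid x_1,s_1,x_2,s_2)$, nonnegative distortion functions $d_i:\mathcal S_i\times\mathcal X_i\to[0,\infty)$ and real numbers $\Delta_i$, $i=1,2$. The host pairs $(S_{1j},S_{2j})$, $j=1,\dots,n$, are i.i.d. with law $p(s_1,s_2)$; the messages $W_i$ are uniform on $\mathcal W_i=\{1,\dots,M_i\}$, independent of each other and of the hosts. A code of block length $n$ consists of encoders $f_i:\mathcal W_i\times\mathcal S_i^n\to\mathcal X_i^n$, $i=1,2$, and a decoder $g:\mathcal Y^n\to\mathcal W_1\times\mathcal S_1^n\times\mathcal W_2\times\mathcal S_2^n$. With $X_i^n=f_i(W_i,S_i^n)$, the output $Y^n$ has conditional law $\prod_{j=1}^n p(y_j\mid x_{1j},s_{1j},x_{2j},s_{2j})$ given the hosts and the embedded signals. Put $$P_e^{n}=\mathbb P\big[g(Y^n)\ne(W_1,S_1^n,W_2,S_2^n)\big],\qquad D_i^{(n)}=\mathbb E\Big[\frac1n\sum_{j=1}^n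 d_i(S_{ij},X_{ij})\Big].$$ A pair $(R_1,R_2)$ with $R_1,R_2\ge0$ is *achievable* for $(\Delta_1,\Delta_2)$ if there is a sequence of codes, one for each block length $n$, with $M_i=\lceil 2^{nR_i}\rceil$, such that the limits $\lim_n D_i^{(n)}$ exist with $\lim_n D_i^{(n)}\le\Delta_i$ for $i=1,2$, and $\lim_n P_e^{n}=0$. The capacity region $\mathcal C(\Delta_1,\Delta_2)$ is the closure of the set of achievable pairs. **Theorem (MAC information embedding, inner bound with recovery of both hosts).** Let $R_1,R_2\ge 0$ satisfy $$\begin{aligned} R_1&<I(X_1,S_1;Y\mid X_2,S_2,Q)-H(S_1\mid S_2),\\ R_2&<I(X_2,S_2;Y\mid X_1,S_1,Q)-H(S_2\mid S_1),\\ R_1+R_2&<I(X_1,S_1,X_2,S_2;Y\mid Q)-H(S_1,S_2) \end{aligned}$$ (entropies in bits) for some random variables $(Q,S_1,S_2,X_1,X_2,Y)$, with $Q$ in a finite alphabet, whose joint distribution has the form $$p(q)\,p(s_1,s_2)\,p(x_1\mid s_1,q)\,p(x_2\mid s_2,q)\,p(y\mid x_1,s_1,x_2,s_2)$$ with the given $p(s_1,s_2)$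 and $p(y\mid x_1,s_1,x_2,s_2)$, and which satisfy $\mathbb E\,d_i(S_i,X_i)\le\Delta_i$ for $i=1,2$. Then $(R_1,R_2)$ is achievable for $(\Delta_1,\Delta_2)$; in particular $(R_1,R_2)\in\mathcal C(\Delta_1,\Delta_2)$. -/

import Mathlib

open Filter Topology

noncomputable section

namespace MACIE

/-! ### Entropy and mutual information (in bits) on a finite sample space

A probability mass function on a finite type `Ω` is a function `p ∈ stdSimplex ℝ Ω`; a random
variable is a function on `Ω`. -/

section Information

variable {Ω α β γ : Type*} [Fintype Ω] [Fintype α] [Fintype β] [Fintype γ]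

open Classical in
/-- The probability `P[X = a]`. -/
def law (p : Ω → ℝ) (X : Ω → α) (a : α) : ℝ :=
  ∑ ω, if X ω = a then p ω else 0

/-- Expectation of a real random variable. -/
def expect (p : Ω → ℝ) (f : Ω → ℝ) : ℝ :=
  ∑ ω, p ω * f ω

/-- `H(X) = - ∑ₐ p(a) log₂ p(a)`. -/
def entropy (p : Ω → ℝ) (X : Ω → α) : ℝ :=
  -∑ a, law p X a * Real.logb 2 (law p X a)

/-- `H(X | Z) = - ∑ p(a, c) log₂ (p(a, c) / p(c))`. -/
def condEntropy (p : Ω → ℝ) (X : Ω → α) (Z : Ω → γ) : ℝ :=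
  -∑ a, ∑ c, law p (fun ω => (X ω, Z ω)) (a, c) *
    Real.logb 2 (law p (fun ω => (X ω, Z ω)) (a, c) / law p Z c)

/-- `I(X; Y | Z) = H(X | Z) - H(X | Y, Z)`. -/
def condMutualInfo (p : Ω → ℝ) (X : Ω → α) (Y : Ω → β) (Z : Ω → γ) : ℝ :=
  condEntropy p X Z - condEntropy p X (fun ω => (Y ω, Z ω))

end Information

/-! ### The channel model -/

/-- The data of the two-user discrete memoryless MAC information embedding problem: the joint law
`p(s₁, s₂)` of one letter of the hosts, the channel `p(y | x₁, s₁, x₂, s₂)`, and the nonnegative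
per-letter distortion functions (bounded, the alphabets being finite). -/
structure Model (S₁ S₂ X₁ X₂ Y : Type*) [Fintype S₁] [Fintype S₂] [Fintype Y] where
  host : S₁ × S₂ → ℝ
  host_mem : host ∈ stdSimplex ℝ (S₁ × S₂)
  channel : X₁ → S₁ → X₂ → S₂ → Y → ℝ
  channel_mem : ∀ x₁ s₁ x₂ s₂, channel x₁ s₁ x₂ s₂ ∈ stdSimplex ℝ Y
  d₁ : S₁ → X₁ → ℝ
  d₁_nonneg : ∀ s x, 0 ≤ d₁ s x
  d₂ : S₂ → X₂ → ℝ
  d₂_nonneg : ∀ s x, 0 ≤ d₂ s x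

/-- A code of block length `n` with message sets of sizes `M₁` and `M₂`, whose decoder puts out
both messages and both host sequences. -/
structure Code (S₁ S₂ X₁ X₂ Y : Type*) (M₁ M₂ n : ℕ) where
  f₁ : Fin M₁ → (Fin n → S₁) → (Fin n → X₁)
  f₂ : Fin M₂ → (Fin n → S₂) → (Fin n → X₂)
  g : (Fin n → Y) → Fin M₁ × (Fin n → S₁) × Fin M₂ × (Fin n → S₂)

/-- One use of the whole system: messages, host sequences and channel output. -/
abbrev Outcome (S₁ S₂ Y : Type*) (M₁ M₂ n : ℕ) : Type _ :=
  (Fin M₁ × (Fin n → S₁) × Fin M₂ × (Fin n → S₂)) × (Fin n → Y)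

variable {S₁ S₂ X₁ X₂ Y : Type*} [Fintype S₁] [Fintype S₂] [Fintype X₁] [Fintype X₂] [Fintype Y]

/-- The joint law of messages (uniform, independent of each other and of the hosts), hosts
(i.i.d. pairs) and channel output (memoryless channel, driven by the encoders' outputs). -/
def Code.jointLaw {M₁ M₂ n : ℕ} (c : Code S₁ S₂ X₁ X₂ Y M₁ M₂ n)
    (m : Model S₁ S₂ X₁ X₂ Y) : Outcome S₁ S₂ Y M₁ M₂ n → ℝ :=
  fun ⟨⟨w₁, s₁, w₂, s₂⟩, y⟩ =>
    (1 / (M₁ : ℝ)) * (1 / (M₂ : ℝ)) * (∏ j, m.host (s₁ j, s₂ j)) *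
      ∏ j, m.channel (c.f₁ w₁ s₁ j) (s₁ j) (c.f₂ w₂ s₂ j) (s₂ j) (y j)

open Classical in
/-- `P[g(Yⁿ) ≠ (W₁, S₁ⁿ, W₂, S₂ⁿ)]`. -/
def Code.errorProb {M₁ M₂ n : ℕ} (c : Code S₁ S₂ X₁ X₂ Y M₁ M₂ n)
    (m : Model S₁ S₂ X₁ X₂ Y) : ℝ :=
  expect (c.jointLaw m) fun ω => if c.g ω.2 ≠ ω.1 then 1 else 0

/-- `E[(1/n) ∑ⱼ d₁(S₁ⱼ, X₁ⱼ)]`. -/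
def Code.distortion₁ {M₁ M₂ n : ℕ} (c : Code S₁ S₂ X₁ X₂ Y M₁ M₂ n)
    (m : Model S₁ S₂ X₁ X₂ Y) : ℝ :=
  expect (c.jointLaw m) fun ⟨⟨w₁, s₁, _, _⟩, _⟩ =>
    (1 / (n : ℝ)) * ∑ j, m.d₁ (s₁ j) (c.f₁ w₁ s₁ j)

/-- `E[(1/n) ∑ⱼ d₂(S₂ⱼ, X₂ⱼ)]`. -/
def Code.distortion₂ {M₁ M₂ n : ℕ} (c : Code S₁ S₂ X₁ X₂ Y M₁ M₂ n)
    (m : Model S₁ S₂ X₁ X₂ Y) : ℝ :=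
  expect (c.jointLaw m) fun ⟨⟨_, _, w₂, s₂⟩, _⟩ =>
    (1 / (n : ℝ)) * ∑ j, m.d₂ (s₂ j) (c.f₂ w₂ s₂ j)

/-- `⌈2^(nR)⌉`. -/
def numMessages (R : ℝ) (n : ℕ) : ℕ := ⌈(2 : ℝ) ^ ((n : ℝ) * R)⌉₊

/-- The set of achievable rate pairs `(R₁, R₂)` (recovery of both hosts) for distortions
`(Δ₁, Δ₂)`: there are codes with `⌈2^(nR₁)⌉` and `⌈2^(nR₂)⌉` messages, one for each block length
`n`, with `lim Dᵢ⁽ⁿ⁾ ≤ Δᵢ` and `lim Pₑⁿ = 0`. -/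
def achievable (m : Model S₁ S₂ X₁ X₂ Y) (Δ₁ Δ₂ : ℝ) : Set (ℝ × ℝ) :=
  {R | 0 ≤ R.1 ∧ 0 ≤ R.2 ∧
    ∃ c : ∀ n : ℕ, Code S₁ S₂ X₁ X₂ Y (numMessages R.1 n) (numMessages R.2 n) n,
      (∃ D₁ ≤ Δ₁, Tendsto (fun n => (c n).distortion₁ m) atTop (𝓝 D₁)) ∧
      (∃ D₂ ≤ Δ₂, Tendsto (fun n => (c n).distortion₂ m) atTop (𝓝 D₂)) ∧
      Tendsto (fun n => (c n).errorProb m) atTop (𝓝 0)}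

/-- The capacity region (recovery of both hosts). -/
def capacityRegion (m : Model S₁ S₂ X₁ X₂ Y) (Δ₁ Δ₂ : ℝ) : Set (ℝ × ℝ) :=
  closure (achievable m Δ₁ Δ₂)

/-! ### The single-letter inner bound -/

/-- The values of `(Q, S₁, S₂, X₁, X₂, Y)`. -/
abbrev Letters (Q S₁ S₂ X₁ X₂ Y : Type*) : Type _ := Q × S₁ × S₂ × X₁ × X₂ × Y

namespace Letters

variable {Q A₁ A₂ B₁ B₂ C : Type*}

/-- The random variable `Q`. -/
def q (ω : Letters Q A₁ A₂ B₁ B₂ C) : Q := ω.1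
/-- The random variable `S₁`. -/
def s₁ (ω : Letters Q A₁ A₂ B₁ B₂ C) : A₁ := ω.2.1
/-- The random variable `S₂`. -/
def s₂ (ω : Letters Q A₁ A₂ B₁ B₂ C) : A₂ := ω.2.2.1
/-- The random variable `X₁`. -/
def x₁ (ω : Letters Q A₁ A₂ B₁ B₂ C) : B₁ := ω.2.2.2.1
/-- The random variable `X₂`. -/
def x₂ (ω : Letters Q A₁ A₂ B₁ B₂ C) : B₂ := ω.2.2.2.2.1
/-- The random variable `Y`. -/
def y (ω : Letters Q A₁ A₂ B₁ B₂ C) : C := ω.2.2.2.2.2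

end Letters

/-- `p` is the joint law of a tuple `(Q, S₁, S₂, X₁, X₂, Y)` such that
`p = p(q) p(s₁, s₂) p(x₁ | s₁, q) p(x₂ | s₂, q) p(y | x₁, s₁, x₂, s₂)`, with the given host law and
channel, and `E dᵢ(Sᵢ, Xᵢ) ≤ Δᵢ`. -/
def IsInnerLaw {Q : Type*} [Fintype Q] (m : Model S₁ S₂ X₁ X₂ Y) (Δ₁ Δ₂ : ℝ)
    (p : Letters Q S₁ S₂ X₁ X₂ Y → ℝ) : Prop :=
  (∃ pQ ∈ stdSimplex ℝ Q, ∃ (p₁ : S₁ → Q → X₁ → ℝ) (p₂ : S₂ → Q → X₂ → ℝ),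
    (∀ s q, p₁ s q ∈ stdSimplex ℝ X₁) ∧ (∀ s q, p₂ s q ∈ stdSimplex ℝ X₂) ∧
    ∀ q s₁ s₂ x₁ x₂ y, p (q, s₁, s₂, x₁, x₂, y) =
      pQ q * m.host (s₁, s₂) * p₁ s₁ q x₁ * p₂ s₂ q x₂ * m.channel x₁ s₁ x₂ s₂ y) ∧
  expect p (fun ω => m.d₁ ω.s₁ ω.x₁) ≤ Δ₁ ∧
  expect p (fun ω => m.d₂ ω.s₂ ω.x₂) ≤ Δ₂

/-- The set of nonnegative rate pairs satisfying the three single-letter inequalities for some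
finite time-sharing alphabet `Q` and some admissible joint law `p`. -/
def innerRegion (m : Model S₁ S₂ X₁ X₂ Y) (Δ₁ Δ₂ : ℝ) : Set (ℝ × ℝ) :=
  {R | 0 ≤ R.1 ∧ 0 ≤ R.2 ∧
    ∃ (Q : Type) (_ : Fintype Q) (p : Letters Q S₁ S₂ X₁ X₂ Y → ℝ), IsInnerLaw m Δ₁ Δ₂ p ∧
      R.1 < condMutualInfo p (fun ω => (ω.x₁, ω.s₁)) (fun ω => ω.y) (fun ω => (ω.x₂, ω.s₂, ω.q))
          - condEntropy p (fun ω => ω.s₁) (fun ω => ω.s₂) ∧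
      R.2 < condMutualInfo p (fun ω => (ω.x₂, ω.s₂)) (fun ω => ω.y) (fun ω => (ω.x₁, ω.s₁, ω.q))
          - condEntropy p (fun ω => ω.s₂) (fun ω => ω.s₁) ∧
      R.1 + R.2 < condMutualInfo p (fun ω => (ω.x₁, ω.s₁, ω.x₂, ω.s₂)) (fun ω => ω.y)
            (fun ω => ω.q)
          - entropy p (fun ω => (ω.s₁, ω.s₂))}

end MACIE

end

/-! This is joint source-channel coding over a multiple access channel with correlated sources: the
source of each user is the pair (message, host sequence), and both pairs have to be recovered. Each
user assigns to every value of its source an independent random codeword, drawn letter by letter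
from `p(xᵢ | sᵢ, q)` along a common time-sharing sequence `q`.

The decoder looks for a pair `(i₁, i₂)` whose weight `P · W` exceeds `t` times three mixtures: the
output weights with the first source, the second source, or both averaged out. A wrong pair may
differ from the true one in the first source, the second, or both. In each case the wrong codewords
are independent of the true ones, so averaging over the true ones turns the output weight into the
matching mixture. That mixture is less than `t⁻¹ P · W` wherever the wrong pair passes the test, and
summing `P · W` over wrong pairs rebuilds at most the mixture. Each case thus costs at most `t⁻¹`,
with no typical sets and no counting of sequences (`confusion_bound`, `oneShot_error_le`).

Over blocks everything factorises. The logarithm of each test ratio is a sum of single-letter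
information densities, less the logarithm of `M₁`, `M₂` or `M₁ M₂`, and the means of the densities
are exactly the right-hand sides of the rate inequalities (`information_eq₁`, `information_eq₂`,
`information_eq₃`). With `t = 2 ^ (nε)`, a mean-square law of large numbers makes rejection of the
true pair an event of probability `O(1/n)`, and it also controls the distortions. Error probability
and squared distortion errors are added into one `Code.risk`, so that a single averaging argument
yields one good code (`exists_code_risk_le`). -/

noncomputable section

namespace MACIE

/-! ### Product measures: resampling, independence of coordinates, law of large numbers. -/

section ProductWeights

variable {ι α : Type*} [Fintype ι] [Fintype α]

/-- The product weight `∏ᵢ μᵢ(fᵢ)` of a family `f`. -/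
def prodWeight (μ : ι → α → ℝ) (f : ι → α) : ℝ := ∏ i, μ i (f i)

omit [Fintype α] in
lemma prodWeight_nonneg {μ : ι → α → ℝ} (hμ : ∀ i a, 0 ≤ μ i a) (f : ι → α) :
    0 ≤ prodWeight μ f :=
  Finset.prod_nonneg fun i _ => hμ i _

-- Exchanging coordinate `i` with a fresh sample preserves the joint weight; written without
-- division, so that zero weights are allowed.
omit [Fintype α] in
lemma prodWeight_update_mul [DecidableEq ι] (μ : ι → α → ℝ) (f : ι → α) (i : ι) (a : α) :
    prodWeight μ (Function.update f i a) * μ i (f i) = prodWeight μ f * μ i a := by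
  unfold prodWeight
  rw [← Finset.mul_prod_erase Finset.univ _ (Finset.mem_univ i),
    ← Finset.mul_prod_erase Finset.univ (fun i => μ i (f i)) (Finset.mem_univ i)]
  have : ∏ x ∈ Finset.univ.erase i, μ x (Function.update f i a x)
      = ∏ x ∈ Finset.univ.erase i, μ x (f x) := by
    refine Finset.prod_congr rfl fun x hx => ?_
    rw [Function.update_of_ne (Finset.ne_of_mem_erase hx)]
  rw [this, Function.update_self]
  ring

lemma sum_prodWeight [DecidableEq ι] {μ : ι → α → ℝ} (hμ : ∀ i, ∑ a, μ i a = 1) :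
    ∑ f, prodWeight μ f = 1 := by
  unfold prodWeight
  rw [← Fintype.prod_sum]
  simp [hμ]

/-- Resampling one coordinate does not change an expectation. -/
lemma sum_prodWeight_update [DecidableEq ι] {μ : ι → α → ℝ} (hμ : ∀ i, ∑ a, μ i a = 1) (i : ι)
    (G : (ι → α) → ℝ) :
    ∑ f, prodWeight μ f * G f
      = ∑ f, prodWeight μ f * ∑ a, μ i a * G (Function.update f i a) := by
  -- Swapping the `i`-th coordinate with the extra sample is a weight-preserving involution, hence a
  -- change of variables.
  have hinv : Function.Involutive
      (fun x : (ι → α) × α => (Function.update x.1 i x.2, x.1 i)) := by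
    rintro ⟨f, a⟩
    simp
  calc ∑ f, prodWeight μ f * G f
      = ∑ x : (ι → α) × α, prodWeight μ x.1 * μ i x.2 * G x.1 := by
        rw [Fintype.sum_prod_type]
        refine Finset.sum_congr rfl fun f _ => ?_
        simp only [mul_right_comm _ (μ i _), ← Finset.mul_sum, hμ, mul_one]
    _ = ∑ x : (ι → α) × α, prodWeight μ (Function.update x.1 i x.2) * μ i (x.1 i) *
          G (Function.update x.1 i x.2) :=
        (Equiv.sum_comp hinv.toPerm
          (fun x : (ι → α) × α => prodWeight μ x.1 * μ i x.2 * G x.1)).symm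
    _ = _ := by
        rw [Fintype.sum_prod_type]
        refine Finset.sum_congr rfl fun f _ => ?_
        rw [Finset.mul_sum]
        refine Finset.sum_congr rfl fun a _ => ?_
        rw [prodWeight_update_mul, mul_assoc]

lemma sum_prodWeight_mul_apply [DecidableEq ι] {μ : ι → α → ℝ} (hμ : ∀ i, ∑ a, μ i a = 1)
    (i : ι) (g : α → ℝ) :
    ∑ f, prodWeight μ f * g (f i) = ∑ a, μ i a * g a := by
  rw [sum_prodWeight_update hμ i]
  simp only [Function.update_self]
  rw [← Finset.sum_mul, sum_prodWeight hμ, one_mul]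

lemma sum_prodWeight_mul_apply₂ [DecidableEq ι] {μ : ι → α → ℝ} (hμ : ∀ i, ∑ a, μ i a = 1)
    {i j : ι} (hij : i ≠ j) (g : α → α → ℝ) :
    ∑ f, prodWeight μ f * g (f i) (f j) = ∑ a, ∑ b, μ i a * μ j b * g a b := by
  rw [sum_prodWeight_update hμ j]
  simp only [Function.update_self, Function.update_of_ne hij]
  rw [sum_prodWeight_mul_apply hμ i (fun a => ∑ b, μ j b * g a b)]
  simp only [Finset.mul_sum, mul_assoc]

/-- The weak law of large numbers in mean square. -/
lemma sum_prodWeight_mul_sq_average {p : α → ℝ} (hp : ∑ a, p a = 1) (f : α → ℝ) {n : ℕ}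
    (hn : n ≠ 0) :
    ∑ ω : Fin n → α, prodWeight (fun _ => p) ω *
        ((1 / (n : ℝ)) * ∑ j, f (ω j) - expect p f) ^ 2
      = expect p (fun a => (f a - expect p f) ^ 2) / n := by
  set c := expect p f with hc
  have hn' : (n : ℝ) ≠ 0 := by exact_mod_cast hn
  have hmean : ∑ a, p a * (f a - c) = 0 := by
    simp only [mul_sub, Finset.sum_sub_distrib, ← Finset.sum_mul, hp]
    simp [hc, expect]
  have hμ : ∀ _ : Fin n, ∑ a, p a = 1 := fun _ => hp
  have hexp : ∀ ω : Fin n → α, ((1 / (n : ℝ)) * ∑ j, f (ω j) - c) ^ 2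
      = (1 / (n : ℝ)) ^ 2 * ∑ j, ∑ k, (f (ω j) - c) * (f (ω k) - c) := by
    intro ω
    rw [← Finset.sum_mul_sum, ← pow_two, ← mul_pow]
    congr 1
    rw [Finset.sum_sub_distrib]
    simp
    field_simp
  simp only [hexp]
  -- Off-diagonal terms vanish by independence and centring, so only the `n` diagonal terms, each
  -- equal to the variance, survive.
  have h2 : ∑ ω : Fin n → α, prodWeight (fun _ => p) ω *
        ∑ j, ∑ k, (f (ω j) - c) * (f (ω k) - c) = n * expect p (fun a => (f a - c) ^ 2) := by
    simp only [Finset.mul_sum]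
    rw [Finset.sum_comm]
    have : ∀ j : Fin n, ∑ ω : Fin n → α, ∑ k, prodWeight (fun _ => p) ω *
        ((f (ω j) - c) * (f (ω k) - c)) = expect p (fun a => (f a - c) ^ 2) := by
      intro j
      rw [Finset.sum_comm, Finset.sum_eq_single j]
      · rw [sum_prodWeight_mul_apply hμ j (fun a => (f a - c) * (f a - c))]
        simp [expect, pow_two]
      · intro k _ hk
        rw [sum_prodWeight_mul_apply₂ hμ (Ne.symm hk) (fun a b => (f a - c) * (f b - c))]
        refine Finset.sum_eq_zero fun a _ => ?_
        have : ∀ b, p a * p b * ((f a - c) * (f b - c))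
            = (p a * (f a - c)) * (p b * (f b - c)) := fun b => by ring
        simp only [this, ← Finset.mul_sum, hmean, mul_zero]
      · simp
    simp [this]
  calc _ = (1 / (n : ℝ)) ^ 2 * ∑ ω : Fin n → α, prodWeight (fun _ => p) ω *
        ∑ j, ∑ k, (f (ω j) - c) * (f (ω k) - c) := by
        rw [Finset.mul_sum]
        exact Finset.sum_congr rfl fun ω _ => by ring
    _ = _ := by
        rw [h2]
        field_simp

end ProductWeights

/-! ### The union bound behind threshold decoding. -/

section Confusion

open Classical in
/-- The indicator of a proposition. -/
def ind (q : Prop) : ℝ := if q then 1 else 0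

lemma ind_true {q : Prop} (h : q) : ind q = 1 := if_pos h

lemma ind_false {q : Prop} (h : ¬q) : ind q = 0 := if_neg h

lemma ind_nonneg (q : Prop) : 0 ≤ ind q := by
  unfold ind
  split_ifs <;> norm_num

lemma ind_le_one (q : Prop) : ind q ≤ 1 := by
  unfold ind
  split_ifs <;> norm_num

/-- The union bound for a threshold test against the output mixture `∑ᵢ aᵢ ∑ₓ pᵢ(x) Vᵢₓ(y)`: a
random codebook `cb` is confused with small probability about pairs of indices at which its
entries are independent. -/
lemma confusion_bound {K I X Y : Type*} [Fintype K] [Fintype I] [Fintype X] [Fintype Y]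
    (ν : K → ℝ) (cb : K → I → X) (r : I → I → Prop) {p : I → X → ℝ} (hp : ∀ i x, 0 ≤ p i x)
    (hpair : ∀ i j, r i j → ∀ g : X → X → ℝ,
      ∑ k, ν k * g (cb k i) (cb k j) = ∑ x, ∑ x', p i x * p j x' * g x x')
    {a : I → ℝ} (ha : ∀ i, 0 ≤ a i) {V : I → X → Y → ℝ} (hV : ∀ i x y, 0 ≤ V i x y)
    {t : ℝ} (ht : 0 < t) {mix : Y → ℝ} (hmix : ∀ y, mix y = ∑ i, ∑ x, a i * p i x * V i x y) :
    ∑ k, ν k * ∑ i, ∑ y, a i * V i (cb k i) y *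
        ∑ j, ind (r i j ∧ t * mix y < a j * V j (cb k j) y)
      ≤ t⁻¹ * ∑ y, mix y := by
  set T : Y → I → X → ℝ := fun y j x => ind (t * mix y < a j * V j x y) with hT
  have hT0 : ∀ y j x, 0 ≤ T y j x := fun y j x => ind_nonneg _
  have hmix0 : ∀ y, 0 ≤ mix y := fun y => by
    rw [hmix]
    exact Finset.sum_nonneg fun i _ => Finset.sum_nonneg fun x _ =>
      mul_nonneg (mul_nonneg (ha i) (hp i x)) (hV i x y)
  -- Change of measure: where the competitor passes the test, the mixture is at most `t⁻¹` times the
  -- competitor's own weight.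
  have hterm : ∀ y j x, mix y * T y j x ≤ t⁻¹ * (a j * V j x y) := by
    intro y j x
    simp only [hT]
    by_cases h : t * mix y < a j * V j x y
    · rw [ind_true h, mul_one, ← div_eq_inv_mul, le_div_iff₀ ht, mul_comm]
      exact h.le
    · rw [ind_false h, mul_zero]
      exact mul_nonneg (inv_nonneg.2 ht.le) (mul_nonneg (ha j) (hV j x y))
  calc ∑ k, ν k * ∑ i, ∑ y, a i * V i (cb k i) y *
        ∑ j, ind (r i j ∧ t * mix y < a j * V j (cb k j) y)
      = ∑ i, ∑ y, ∑ j, ∑ k, ν k * (a i * V i (cb k i) y *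
          ind (r i j ∧ t * mix y < a j * V j (cb k j) y)) := by
        simp only [Finset.mul_sum]
        rw [Finset.sum_comm]
        refine Finset.sum_congr rfl fun i _ => ?_
        rw [Finset.sum_comm]
        refine Finset.sum_congr rfl fun y _ => ?_
        rw [Finset.sum_comm]
    _ ≤ ∑ i, ∑ y, ∑ j, ∑ x, ∑ x', p i x * p j x' * (a i * V i x y * T y j x') := by
        refine Finset.sum_le_sum fun i _ => Finset.sum_le_sum fun y _ =>
          Finset.sum_le_sum fun j _ => ?_
        by_cases hr : r i j
        · simp only [hr, true_and]
          exact (hpair i j hr (fun x x' => a i * V i x y * T y j x')).le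
        · simp only [hr, false_and, ind_false not_false, mul_zero, Finset.sum_const_zero]
          exact Finset.sum_nonneg fun x _ => Finset.sum_nonneg fun x' _ =>
            mul_nonneg (mul_nonneg (hp i x) (hp j x'))
              (mul_nonneg (mul_nonneg (ha i) (hV i x y)) (hT0 _ _ _))
    -- Independence decouples the true entry from the competitor, and averaging over the true index
    -- and entry produces the mixture.
    _ = ∑ y, ∑ j, ∑ x', p j x' * (mix y * T y j x') := by
        rw [Finset.sum_comm]
        refine Finset.sum_congr rfl fun y _ => ?_
        rw [Finset.sum_comm]
        refine Finset.sum_congr rfl fun j _ => ?_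
        simp only [hmix, Finset.sum_mul, Finset.mul_sum]
        symm
        rw [Finset.sum_comm]
        refine Finset.sum_congr rfl fun i _ => ?_
        rw [Finset.sum_comm]
        exact Finset.sum_congr rfl fun x _ => Finset.sum_congr rfl fun x' _ => by ring
    _ ≤ ∑ y, ∑ j, ∑ x', p j x' * (t⁻¹ * (a j * V j x' y)) :=
        Finset.sum_le_sum fun y _ => Finset.sum_le_sum fun j _ => Finset.sum_le_sum fun x _ =>
          mul_le_mul_of_nonneg_left (hterm y j x) (hp j x)
    -- Summed over all competitors, their weights form the mixture once more; the number of indices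
    -- never enters.
    _ = t⁻¹ * ∑ y, mix y := by
        simp only [hmix, Finset.mul_sum]
        refine Finset.sum_congr rfl fun y _ => Finset.sum_congr rfl fun j _ =>
          Finset.sum_congr rfl fun x _ => by ring

end Confusion

/-! ### One-shot random coding bound for two correlated sources. -/

section OneShot

variable {I₁ I₂ X₁ X₂ Y : Type*} [Fintype I₁] [Fintype I₂] [Fintype X₁] [Fintype X₂] [Fintype Y]

/-- The joint weight of sources, inputs and output. -/
def jointWeight (P : I₁ → I₂ → ℝ) (p₁ : I₁ → X₁ → ℝ) (p₂ : I₂ → X₂ → ℝ)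
    (W : I₁ → X₁ → I₂ → X₂ → Y → ℝ) (i₁ : I₁) (x₁ : X₁) (i₂ : I₂) (x₂ : X₂) (y : Y) : ℝ :=
  P i₁ i₂ * p₁ i₁ x₁ * p₂ i₂ x₂ * W i₁ x₁ i₂ x₂ y

/-- The weight of the second source and the output, given the second input. -/
def mix₁ (P : I₁ → I₂ → ℝ) (p₁ : I₁ → X₁ → ℝ) (W : I₁ → X₁ → I₂ → X₂ → Y → ℝ)
    (i₂ : I₂) (x₂ : X₂) (y : Y) : ℝ :=
  ∑ i₁, ∑ x₁, P i₁ i₂ * p₁ i₁ x₁ * W i₁ x₁ i₂ x₂ y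

/-- The weight of the first source and the output, given the first input. -/
def mix₂ (P : I₁ → I₂ → ℝ) (p₂ : I₂ → X₂ → ℝ) (W : I₁ → X₁ → I₂ → X₂ → Y → ℝ)
    (i₁ : I₁) (x₁ : X₁) (y : Y) : ℝ :=
  ∑ i₂, ∑ x₂, P i₁ i₂ * p₂ i₂ x₂ * W i₁ x₁ i₂ x₂ y

/-- The weight of the output. -/
def mix₃ (P : I₁ → I₂ → ℝ) (p₁ : I₁ → X₁ → ℝ) (p₂ : I₂ → X₂ → ℝ)
    (W : I₁ → X₁ → I₂ → X₂ → Y → ℝ) (y : Y) : ℝ :=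
  ∑ i₁, ∑ i₂, ∑ x₁, ∑ x₂, jointWeight P p₁ p₂ W i₁ x₁ i₂ x₂ y

/-- The threshold test of the decoder. -/
def Accept (P : I₁ → I₂ → ℝ) (p₁ : I₁ → X₁ → ℝ) (p₂ : I₂ → X₂ → ℝ)
    (W : I₁ → X₁ → I₂ → X₂ → Y → ℝ) (t : ℝ) (i₁ : I₁) (x₁ : X₁) (i₂ : I₂) (x₂ : X₂) (y : Y) :
    Prop :=
  t * mix₁ P p₁ W i₂ x₂ y < P i₁ i₂ * W i₁ x₁ i₂ x₂ y ∧
  t * mix₂ P p₂ W i₁ x₁ y < P i₁ i₂ * W i₁ x₁ i₂ x₂ y ∧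
  t * mix₃ P p₁ p₂ W y < P i₁ i₂ * W i₁ x₁ i₂ x₂ y

open Classical in
/-- The threshold decoder. -/
def thresholdDecoder [Nonempty I₁] [Nonempty I₂] (P : I₁ → I₂ → ℝ) (p₁ : I₁ → X₁ → ℝ)
    (p₂ : I₂ → X₂ → ℝ) (W : I₁ → X₁ → I₂ → X₂ → Y → ℝ) (t : ℝ) (c₁ : I₁ → X₁) (c₂ : I₂ → X₂)
    (y : Y) : I₁ × I₂ :=
  if h : ∃ i : I₁ × I₂, Accept P p₁ p₂ W t i.1 (c₁ i.1) i.2 (c₂ i.2) y then h.choose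
  else Classical.arbitrary _

/-- Averaging over random codebooks gives the joint weight. -/
lemma sum_codebooks [DecidableEq I₁] [DecidableEq I₂] (P : I₁ → I₂ → ℝ)
    {p₁ : I₁ → X₁ → ℝ} {p₂ : I₂ → X₂ → ℝ} (h₁ : ∀ i, ∑ x, p₁ i x = 1) (h₂ : ∀ i, ∑ x, p₂ i x = 1)
    (W : I₁ → X₁ → I₂ → X₂ → Y → ℝ) (G : I₁ → X₁ → I₂ → X₂ → Y → ℝ) :
    ∑ c₁, ∑ c₂, prodWeight p₁ c₁ * prodWeight p₂ c₂ *
        ∑ i₁, ∑ i₂, ∑ y, P i₁ i₂ * W i₁ (c₁ i₁) i₂ (c₂ i₂) y * G i₁ (c₁ i₁) i₂ (c₂ i₂) y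
      = ∑ i₁, ∑ i₂, ∑ x₁, ∑ x₂, ∑ y, jointWeight P p₁ p₂ W i₁ x₁ i₂ x₂ y * G i₁ x₁ i₂ x₂ y := by
  have inner : ∀ c₁ : I₁ → X₁, ∑ c₂, prodWeight p₁ c₁ * prodWeight p₂ c₂ *
        ∑ i₁, ∑ i₂, ∑ y, P i₁ i₂ * W i₁ (c₁ i₁) i₂ (c₂ i₂) y * G i₁ (c₁ i₁) i₂ (c₂ i₂) y
      = ∑ i₁, ∑ i₂, prodWeight p₁ c₁ * ∑ x₂, p₂ i₂ x₂ *
          ∑ y, P i₁ i₂ * W i₁ (c₁ i₁) i₂ x₂ y * G i₁ (c₁ i₁) i₂ x₂ y := by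
    intro c₁
    simp only [mul_assoc, ← Finset.mul_sum]
    congr 1
    simp only [Finset.mul_sum]
    rw [Finset.sum_comm]
    refine Finset.sum_congr rfl fun i₁ _ => ?_
    rw [Finset.sum_comm]
    refine Finset.sum_congr rfl fun i₂ _ => ?_
    simpa only [Finset.mul_sum] using sum_prodWeight_mul_apply h₂ i₂
      (fun x₂ => ∑ y, P i₁ i₂ * (W i₁ (c₁ i₁) i₂ x₂ y * G i₁ (c₁ i₁) i₂ x₂ y))
  simp only [inner]
  rw [Finset.sum_comm]
  refine Finset.sum_congr rfl fun i₁ _ => ?_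
  rw [Finset.sum_comm]
  refine Finset.sum_congr rfl fun i₂ _ => ?_
  rw [sum_prodWeight_mul_apply h₁ i₁ (fun x₁ => ∑ x₂, p₂ i₂ x₂ *
          ∑ y, P i₁ i₂ * W i₁ x₁ i₂ x₂ y * G i₁ x₁ i₂ x₂ y)]
  simp only [Finset.mul_sum, jointWeight]
  refine Finset.sum_congr rfl fun x₁ _ => Finset.sum_congr rfl fun x₂ _ =>
    Finset.sum_congr rfl fun y _ => by ring

-- If the true pair is accepted, a wrong decoder output is another accepted pair. Whether it differs
-- in the first index, the second or both decides which one of the three threshold conditions is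
-- used. In the first two cases the mixture at the wrong pair reads only the shared correct index,
-- so it coincides with the mixture at the true pair.
omit [Fintype Y] in
lemma thresholdDecoder_error_le [Nonempty I₁] [Nonempty I₂] (P : I₁ → I₂ → ℝ) (p₁ : I₁ → X₁ → ℝ)
    (p₂ : I₂ → X₂ → ℝ) (W : I₁ → X₁ → I₂ → X₂ → Y → ℝ) (t : ℝ) (c₁ : I₁ → X₁) (c₂ : I₂ → X₂)
    (i₁ : I₁) (i₂ : I₂) (y : Y) :
    ind (thresholdDecoder P p₁ p₂ W t c₁ c₂ y ≠ (i₁, i₂)) ≤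
      ind (¬Accept P p₁ p₂ W t i₁ (c₁ i₁) i₂ (c₂ i₂) y)
      + ∑ j₁, ind (i₁ ≠ j₁ ∧ t * mix₁ P p₁ W i₂ (c₂ i₂) y
            < P j₁ i₂ * W j₁ (c₁ j₁) i₂ (c₂ i₂) y)
      + ∑ j₂, ind (i₂ ≠ j₂ ∧ t * mix₂ P p₂ W i₁ (c₁ i₁) y
            < P i₁ j₂ * W i₁ (c₁ i₁) j₂ (c₂ j₂) y)
      + ∑ j : I₁ × I₂, ind ((i₁ ≠ j.1 ∧ i₂ ≠ j.2) ∧ t * mix₃ P p₁ p₂ W y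
            < P j.1 j.2 * W j.1 (c₁ j.1) j.2 (c₂ j.2) y) := by
  have n1 := Finset.sum_nonneg fun j₁ (_ : j₁ ∈ Finset.univ) =>
    ind_nonneg (i₁ ≠ j₁ ∧ t * mix₁ P p₁ W i₂ (c₂ i₂) y < P j₁ i₂ * W j₁ (c₁ j₁) i₂ (c₂ i₂) y)
  have n2 := Finset.sum_nonneg fun j₂ (_ : j₂ ∈ Finset.univ) =>
    ind_nonneg (i₂ ≠ j₂ ∧ t * mix₂ P p₂ W i₁ (c₁ i₁) y < P i₁ j₂ * W i₁ (c₁ i₁) j₂ (c₂ j₂) y)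
  have n3 := Finset.sum_nonneg fun (j : I₁ × I₂) (_ : j ∈ Finset.univ) =>
    ind_nonneg ((i₁ ≠ j.1 ∧ i₂ ≠ j.2) ∧ t * mix₃ P p₁ p₂ W y
            < P j.1 j.2 * W j.1 (c₁ j.1) j.2 (c₂ j.2) y)
  by_cases hA : Accept P p₁ p₂ W t i₁ (c₁ i₁) i₂ (c₂ i₂) y
  swap
  · rw [ind_true hA]
    linarith [ind_le_one (thresholdDecoder P p₁ p₂ W t c₁ c₂ y ≠ (i₁, i₂))]
  rw [ind_false (not_not.2 hA), zero_add]
  by_cases hne : thresholdDecoder P p₁ p₂ W t c₁ c₂ y ≠ (i₁, i₂)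
  swap
  · rw [ind_false hne]
    linarith
  rw [ind_true hne]
  have hex : ∃ i : I₁ × I₂, Accept P p₁ p₂ W t i.1 (c₁ i.1) i.2 (c₂ i.2) y := ⟨(i₁, i₂), hA⟩
  have hdec : Accept P p₁ p₂ W t (thresholdDecoder P p₁ p₂ W t c₁ c₂ y).1
      (c₁ (thresholdDecoder P p₁ p₂ W t c₁ c₂ y).1) (thresholdDecoder P p₁ p₂ W t c₁ c₂ y).2
      (c₂ (thresholdDecoder P p₁ p₂ W t c₁ c₂ y).2) y := by
    unfold thresholdDecoder
    rw [dif_pos hex]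
    exact hex.choose_spec
  -- Which accepted pair is chosen is irrelevant: only that it is accepted and wrong.
  generalize thresholdDecoder P p₁ p₂ W t c₁ c₂ y = j at hne hdec
  obtain ⟨j₁, j₂⟩ := j
  obtain ⟨a1, a2, a3⟩ := hdec
  by_cases e1 : i₁ = j₁
  · have e2 : i₂ ≠ j₂ := fun e2 => hne (by rw [e1, e2])
    subst e1
    have := Finset.single_le_sum (fun j₂ (_ : j₂ ∈ Finset.univ) =>
      ind_nonneg (i₂ ≠ j₂ ∧ t * mix₂ P p₂ W i₁ (c₁ i₁) y < P i₁ j₂ * W i₁ (c₁ i₁) j₂ (c₂ j₂) y))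
      (Finset.mem_univ j₂)
    rw [ind_true ⟨e2, a2⟩] at this
    linarith
  by_cases e2 : i₂ = j₂
  · subst e2
    have := Finset.single_le_sum (fun j₁ (_ : j₁ ∈ Finset.univ) =>
      ind_nonneg (i₁ ≠ j₁ ∧ t * mix₁ P p₁ W i₂ (c₂ i₂) y < P j₁ i₂ * W j₁ (c₁ j₁) i₂ (c₂ i₂) y))
      (Finset.mem_univ j₁)
    rw [ind_true ⟨e1, a1⟩] at this
    linarith
  · have := Finset.single_le_sum (fun (j : I₁ × I₂) (_ : j ∈ Finset.univ) =>
      ind_nonneg ((i₁ ≠ j.1 ∧ i₂ ≠ j.2) ∧ t * mix₃ P p₁ p₂ W y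
            < P j.1 j.2 * W j.1 (c₁ j.1) j.2 (c₂ j.2) y)) (Finset.mem_univ (j₁, j₂))
    rw [ind_true ⟨⟨e1, e2⟩, a3⟩] at this
    linarith

/-- The one-shot random coding bound for the multiple access channel with correlated sources. -/
theorem oneShot_error_le [DecidableEq I₁] [DecidableEq I₂] [Nonempty I₁] [Nonempty I₂]
    {P : I₁ → I₂ → ℝ} {p₁ : I₁ → X₁ → ℝ} {p₂ : I₂ → X₂ → ℝ} {W : I₁ → X₁ → I₂ → X₂ → Y → ℝ}
    (hP : ∀ i₁ i₂, 0 ≤ P i₁ i₂) (hP1 : ∑ i₁, ∑ i₂, P i₁ i₂ = 1)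
    (h₁ : ∀ i, p₁ i ∈ stdSimplex ℝ X₁) (h₂ : ∀ i, p₂ i ∈ stdSimplex ℝ X₂)
    (hW : ∀ i₁ x₁ i₂ x₂, W i₁ x₁ i₂ x₂ ∈ stdSimplex ℝ Y) {t : ℝ} (ht : 0 < t) :
    ∑ c₁, ∑ c₂, prodWeight p₁ c₁ * prodWeight p₂ c₂ *
        ∑ i₁, ∑ i₂, ∑ y, P i₁ i₂ * W i₁ (c₁ i₁) i₂ (c₂ i₂) y *
          ind (thresholdDecoder P p₁ p₂ W t c₁ c₂ y ≠ (i₁, i₂))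
      ≤ (∑ i₁, ∑ i₂, ∑ x₁, ∑ x₂, ∑ y, jointWeight P p₁ p₂ W i₁ x₁ i₂ x₂ y *
          ind (¬Accept P p₁ p₂ W t i₁ x₁ i₂ x₂ y)) + 3 * t⁻¹ := by
  have hpw₁ : ∀ c₁ : I₁ → X₁, 0 ≤ prodWeight p₁ c₁ := prodWeight_nonneg fun i => (h₁ i).1
  have hpw₂ : ∀ c₂ : I₂ → X₂, 0 ≤ prodWeight p₂ c₂ := prodWeight_nonneg fun i => (h₂ i).1
  have s₁ := fun i => (h₁ i).2
  have s₂ := fun i => (h₂ i).2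
  set E₁ : (I₁ → X₁) → (I₂ → X₂) → I₁ → I₂ → Y → ℝ := fun c₁ c₂ i₁ i₂ y =>
    ∑ j₁, ind (i₁ ≠ j₁ ∧ t * mix₁ P p₁ W i₂ (c₂ i₂) y
            < P j₁ i₂ * W j₁ (c₁ j₁) i₂ (c₂ i₂) y) with hE₁
  set E₂ : (I₁ → X₁) → (I₂ → X₂) → I₁ → I₂ → Y → ℝ := fun c₁ c₂ i₁ i₂ y =>
    ∑ j₂, ind (i₂ ≠ j₂ ∧ t * mix₂ P p₂ W i₁ (c₁ i₁) y
            < P i₁ j₂ * W i₁ (c₁ i₁) j₂ (c₂ j₂) y) with hE₂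
  set E₃ : (I₁ → X₁) → (I₂ → X₂) → I₁ → I₂ → Y → ℝ := fun c₁ c₂ i₁ i₂ y =>
    ∑ j : I₁ × I₂, ind ((i₁ ≠ j.1 ∧ i₂ ≠ j.2) ∧ t * mix₃ P p₁ p₂ W y
            < P j.1 j.2 * W j.1 (c₁ j.1) j.2 (c₂ j.2) y) with hE₃
  have b₁ : ∑ c₁, ∑ c₂, prodWeight p₁ c₁ * prodWeight p₂ c₂ *
        ∑ i₁, ∑ i₂, ∑ y, P i₁ i₂ * W i₁ (c₁ i₁) i₂ (c₂ i₂) y * E₁ c₁ c₂ i₁ i₂ y ≤ t⁻¹ := by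
    -- With the second codebook and source frozen, this is a single-user confusion problem for the
    -- first codebook.
    have key : ∀ c₂ : I₂ → X₂, ∀ i₂, ∑ c₁, prodWeight p₁ c₁ *
        ∑ i₁, ∑ y, P i₁ i₂ * W i₁ (c₁ i₁) i₂ (c₂ i₂) y * E₁ c₁ c₂ i₁ i₂ y
          ≤ t⁻¹ * ∑ i₁, P i₁ i₂ := by
      intro c₂ i₂
      refine (confusion_bound (prodWeight p₁) (fun c => c) (· ≠ ·) (fun i => (h₁ i).1)
        (fun i j hij g => sum_prodWeight_mul_apply₂ s₁ hij g) (a := fun i₁ => P i₁ i₂)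
        (fun i₁ => hP i₁ i₂) (V := fun i₁ x₁ y => W i₁ x₁ i₂ (c₂ i₂) y)
        (fun _ _ _ => (hW _ _ _ _).1 _) ht (mix := mix₁ P p₁ W i₂ (c₂ i₂)) fun y => rfl).trans
        (le_of_eq ?_)
      congr 1
      unfold mix₁
      rw [Finset.sum_comm]
      refine Finset.sum_congr rfl fun i₁ _ => ?_
      rw [Finset.sum_comm]
      simp only [← Finset.mul_sum, (hW _ _ _ _).2, s₁, mul_one]
    calc _ = ∑ c₂, prodWeight p₂ c₂ * ∑ i₂, ∑ c₁, prodWeight p₁ c₁ *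
          ∑ i₁, ∑ y, P i₁ i₂ * W i₁ (c₁ i₁) i₂ (c₂ i₂) y * E₁ c₁ c₂ i₁ i₂ y := by
          rw [Finset.sum_comm]
          refine Finset.sum_congr rfl fun c₂ _ => ?_
          simp only [mul_comm (prodWeight p₁ _) (prodWeight p₂ _), mul_assoc, ← Finset.mul_sum]
          congr 1
          rw [Finset.sum_comm]
          refine Finset.sum_congr rfl fun c₁ _ => ?_
          rw [← Finset.mul_sum]
          congr 1
          exact Finset.sum_comm
      _ ≤ ∑ c₂, prodWeight p₂ c₂ * ∑ i₂, t⁻¹ * ∑ i₁, P i₁ i₂ := by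
          gcongr with c₂ _ i₂ _
          · exact hpw₂ c₂
          · exact key c₂ i₂
      _ = t⁻¹ := by
          rw [← Finset.sum_mul, sum_prodWeight s₂, one_mul, ← Finset.mul_sum, Finset.sum_comm,
            hP1, mul_one]
  have b₂ : ∑ c₁, ∑ c₂, prodWeight p₁ c₁ * prodWeight p₂ c₂ *
        ∑ i₁, ∑ i₂, ∑ y, P i₁ i₂ * W i₁ (c₁ i₁) i₂ (c₂ i₂) y * E₂ c₁ c₂ i₁ i₂ y ≤ t⁻¹ := by
    have key : ∀ c₁ : I₁ → X₁, ∀ i₁, ∑ c₂, prodWeight p₂ c₂ *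
        ∑ i₂, ∑ y, P i₁ i₂ * W i₁ (c₁ i₁) i₂ (c₂ i₂) y * E₂ c₁ c₂ i₁ i₂ y
          ≤ t⁻¹ * ∑ i₂, P i₁ i₂ := by
      intro c₁ i₁
      refine (confusion_bound (prodWeight p₂) (fun c => c) (· ≠ ·) (fun i => (h₂ i).1)
        (fun i j hij g => sum_prodWeight_mul_apply₂ s₂ hij g) (a := fun i₂ => P i₁ i₂)
        (fun i₂ => hP i₁ i₂) (V := fun i₂ x₂ y => W i₁ (c₁ i₁) i₂ x₂ y)
        (fun _ _ _ => (hW _ _ _ _).1 _) ht (mix := mix₂ P p₂ W i₁ (c₁ i₁)) fun y => rfl).trans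
        (le_of_eq ?_)
      congr 1
      unfold mix₂
      rw [Finset.sum_comm]
      refine Finset.sum_congr rfl fun i₂ _ => ?_
      rw [Finset.sum_comm]
      simp only [← Finset.mul_sum, (hW _ _ _ _).2, s₂, mul_one]
    calc _ = ∑ c₁, prodWeight p₁ c₁ * ∑ i₁, ∑ c₂, prodWeight p₂ c₂ *
          ∑ i₂, ∑ y, P i₁ i₂ * W i₁ (c₁ i₁) i₂ (c₂ i₂) y * E₂ c₁ c₂ i₁ i₂ y := by
          refine Finset.sum_congr rfl fun c₁ _ => ?_
          simp only [mul_assoc, ← Finset.mul_sum]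
          congr 1
          rw [Finset.sum_comm]
          refine Finset.sum_congr rfl fun c₂ _ => ?_
          rw [← Finset.mul_sum]
      _ ≤ ∑ c₁, prodWeight p₁ c₁ * ∑ i₁, t⁻¹ * ∑ i₂, P i₁ i₂ := by
          gcongr with c₁ _ i₁ _
          · exact hpw₁ c₁
          · exact key c₁ i₁
      _ = t⁻¹ := by
          rw [← Finset.sum_mul, sum_prodWeight s₁, one_mul, ← Finset.mul_sum, hP1, mul_one]
  have b₃ : ∑ c₁, ∑ c₂, prodWeight p₁ c₁ * prodWeight p₂ c₂ *
        ∑ i₁, ∑ i₂, ∑ y, P i₁ i₂ * W i₁ (c₁ i₁) i₂ (c₂ i₂) y * E₃ c₁ c₂ i₁ i₂ y ≤ t⁻¹ := by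
    -- Pairs are treated as one index. Codeword pairs are independent only when both coordinates
    -- differ, which is why the other two cases are handled separately.
    have key := confusion_bound (K := (I₁ → X₁) × (I₂ → X₂)) (I := I₁ × I₂) (X := X₁ × X₂)
      (fun c => prodWeight p₁ c.1 * prodWeight p₂ c.2) (fun c i => (c.1 i.1, c.2 i.2))
      (fun i j => i.1 ≠ j.1 ∧ i.2 ≠ j.2) (p := fun i x => p₁ i.1 x.1 * p₂ i.2 x.2)
      (fun i x => mul_nonneg ((h₁ _).1 _) ((h₂ _).1 _)) (fun i j hij g => by
        simp only [Fintype.sum_prod_type, mul_assoc, ← Finset.mul_sum]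
        have hin : ∀ c₁ : I₁ → X₁, ∑ c₂, prodWeight p₂ c₂ * g (c₁ i.1, c₂ i.2) (c₁ j.1, c₂ j.2)
            = ∑ b, ∑ b', p₂ i.2 b * p₂ j.2 b' * g (c₁ i.1, b) (c₁ j.1, b') := fun c₁ =>
          sum_prodWeight_mul_apply₂ s₂ hij.2 (fun a b => g (c₁ i.1, a) (c₁ j.1, b))
        simp only [hin]
        rw [sum_prodWeight_mul_apply₂ s₁ hij.1
          (fun a a' => ∑ b, ∑ b', p₂ i.2 b * p₂ j.2 b' * g (a, b) (a', b'))]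
        refine Finset.sum_congr rfl fun x _ => ?_
        simp only [Finset.mul_sum]
        rw [Finset.sum_comm]
        refine Finset.sum_congr rfl fun x₂ _ => Finset.sum_congr rfl fun x' _ =>
          Finset.sum_congr rfl fun x₂' _ => by ring)
      (a := fun i => P i.1 i.2) (fun i => hP _ _)
      (V := fun i x y => W i.1 x.1 i.2 x.2 y) (fun _ _ _ => (hW _ _ _ _).1 _) ht
      (mix := mix₃ P p₁ p₂ W) (fun y => by
        simp only [mix₃, jointWeight, Fintype.sum_prod_type, mul_assoc])
    have hmix : ∑ y, mix₃ P p₁ p₂ W y = 1 := by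
      rw [← hP1]
      unfold mix₃ jointWeight
      rw [Finset.sum_comm]
      refine Finset.sum_congr rfl fun i₁ _ => ?_
      rw [Finset.sum_comm]
      refine Finset.sum_congr rfl fun i₂ _ => ?_
      rw [Finset.sum_comm]
      simp only [Finset.sum_comm (s := Finset.univ (α := Y)) (t := Finset.univ (α := X₂)),
        ← Finset.mul_sum, (hW _ _ _ _).2, s₁, s₂, mul_one]
    rw [hmix, mul_one] at key
    refine le_trans (le_of_eq ?_) key
    simp only [Fintype.sum_prod_type, hE₃]
  have b₀ := sum_codebooks P s₁ s₂ W
    (fun i₁ x₁ i₂ x₂ y => ind (¬Accept P p₁ p₂ W t i₁ x₁ i₂ x₂ y))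
  calc _ ≤ ∑ c₁, ∑ c₂, prodWeight p₁ c₁ * prodWeight p₂ c₂ *
        ∑ i₁, ∑ i₂, ∑ y, P i₁ i₂ * W i₁ (c₁ i₁) i₂ (c₂ i₂) y *
          (ind (¬Accept P p₁ p₂ W t i₁ (c₁ i₁) i₂ (c₂ i₂) y)
            + E₁ c₁ c₂ i₁ i₂ y + E₂ c₁ c₂ i₁ i₂ y + E₃ c₁ c₂ i₁ i₂ y) := by
        gcongr with c₁ _ c₂ _ i₁ _ i₂ _ y _
        · exact mul_nonneg (hpw₁ c₁) (hpw₂ c₂)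
        · exact mul_nonneg (hP _ _) ((hW _ _ _ _).1 _)
        · exact thresholdDecoder_error_le P p₁ p₂ W t c₁ c₂ i₁ i₂ y
    _ ≤ _ := by
        simp only [mul_add, Finset.sum_add_distrib]
        linarith

end OneShot

/-! ### Entropies as expectations of log-likelihoods. -/

section Information

variable {Ω α β γ : Type*} [Fintype Ω] [Fintype α] [Fintype β] [Fintype γ]

omit [Fintype α] in
lemma law_eq_sum_ite [DecidableEq α] (p : Ω → ℝ) (X : Ω → α) (a : α) :
    law p X a = ∑ ω, if X ω = a then p ω else 0 := by
  unfold law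
  congr! 2

lemma sum_law_mul (p : Ω → ℝ) (X : Ω → α) (F : α → ℝ) :
    ∑ a, law p X a * F a = ∑ ω, p ω * F (X ω) := by
  classical
  simp only [law_eq_sum_ite, Finset.sum_mul]
  rw [Finset.sum_comm]
  simp

lemma entropy_eq_sum (p : Ω → ℝ) (X : Ω → α) :
    entropy p X = -∑ ω, p ω * Real.logb 2 (law p X (X ω)) := by
  rw [entropy, sum_law_mul p X fun a => Real.logb 2 (law p X a)]

lemma condEntropy_eq_sum (p : Ω → ℝ) (X : Ω → α) (Z : Ω → γ) :
    condEntropy p X Z = -∑ ω, p ω *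
      Real.logb 2 (law p (fun ω => (X ω, Z ω)) (X ω, Z ω) / law p Z (Z ω)) := by
  rw [condEntropy, ← sum_law_mul p (fun ω => (X ω, Z ω)) fun ac =>
    Real.logb 2 (law p (fun ω => (X ω, Z ω)) ac / law p Z ac.2), Fintype.sum_prod_type]

end Information

set_option linter.unusedSimpArgs false

lemma sum_ne_zero_of_nonneg {ι : Type*} [Fintype ι] {f : ι → ℝ} (hf : ∀ i, 0 ≤ f i) {i : ι}
    (hi : f i ≠ 0) : ∑ i, f i ≠ 0 := fun h =>
  hi ((Finset.sum_eq_zero_iff_of_nonneg fun j _ => hf j).1 h i (Finset.mem_univ i))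

/-! ### Positivity of the mixtures on the support of the joint law. -/

section MixNeZero

variable {S₁ S₂ X₁ X₂ Y : Type*} [Fintype S₁] [Fintype S₂] [Fintype X₁] [Fintype X₂]
  {P : S₁ → S₂ → ℝ} {p₁ : S₁ → X₁ → ℝ} {p₂ : S₂ → X₂ → ℝ} {W : S₁ → X₁ → S₂ → X₂ → Y → ℝ}
  (hP : ∀ s₁ s₂, 0 ≤ P s₁ s₂) (h₁ : ∀ s x, 0 ≤ p₁ s x) (h₂ : ∀ s x, 0 ≤ p₂ s x)
  (hW : ∀ s₁ x₁ s₂ x₂ y, 0 ≤ W s₁ x₁ s₂ x₂ y)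
  {a : S₁} {b : S₂} {c : X₁} {d : X₂} {y : Y}
  (hab : P a b ≠ 0) (hc : p₁ a c ≠ 0) (hd : p₂ b d ≠ 0) (hy : W a c b d y ≠ 0)

include hP h₁ h₂ hW hab hc hd hy

omit [Fintype S₂] [Fintype X₂] h₂ hd in
lemma mix₁_ne_zero : mix₁ P p₁ W b d y ≠ 0 := by
  have hn : ∀ s x, 0 ≤ P s b * p₁ s x * W s x b d y := fun s x =>
    mul_nonneg (mul_nonneg (hP _ _) (h₁ _ _)) (hW _ _ _ _ _)
  exact sum_ne_zero_of_nonneg (fun s => Finset.sum_nonneg fun x _ => hn s x) (i := a)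
    (sum_ne_zero_of_nonneg (hn a) (i := c) (mul_ne_zero (mul_ne_zero hab hc) hy))

omit [Fintype S₁] [Fintype X₁] h₁ hc in
lemma mix₂_ne_zero : mix₂ P p₂ W a c y ≠ 0 := by
  have hn : ∀ s x, 0 ≤ P a s * p₂ s x * W a c s x y := fun s x =>
    mul_nonneg (mul_nonneg (hP _ _) (h₂ _ _)) (hW _ _ _ _ _)
  exact sum_ne_zero_of_nonneg (fun s => Finset.sum_nonneg fun x _ => hn s x) (i := b)
    (sum_ne_zero_of_nonneg (hn b) (i := d) (mul_ne_zero (mul_ne_zero hab hd) hy))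

lemma mix₃_ne_zero : mix₃ P p₁ p₂ W y ≠ 0 := by
  have hn : ∀ a b c d, 0 ≤ jointWeight P p₁ p₂ W a c b d y := fun a b c d =>
    mul_nonneg (mul_nonneg (mul_nonneg (hP _ _) (h₁ _ _)) (h₂ _ _)) (hW _ _ _ _ _)
  exact sum_ne_zero_of_nonneg (fun a => Finset.sum_nonneg fun b _ => Finset.sum_nonneg fun c _ =>
      Finset.sum_nonneg fun d _ => hn a b c d) (i := a)
    (sum_ne_zero_of_nonneg (fun b => Finset.sum_nonneg fun c _ =>
      Finset.sum_nonneg fun d _ => hn a b c d) (i := b)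
    (sum_ne_zero_of_nonneg (fun c => Finset.sum_nonneg fun d _ => hn a b c d) (i := c)
    (sum_ne_zero_of_nonneg (hn a b c) (i := d)
      (mul_ne_zero (mul_ne_zero (mul_ne_zero hab hc) hd) hy))))

end MixNeZero

/-! ### Single-letter information quantities as means of information densities. -/

section Letter

variable {Q S₁ S₂ X₁ X₂ Y : Type*} [Fintype Q] [Fintype S₁] [Fintype S₂] [Fintype X₁]
  [Fintype X₂] [Fintype Y]

/-- The letter-level joint law
`p(q) p(s₁, s₂) p(x₁ | s₁, q) p(x₂ | s₂, q) p(y | x₁, s₁, x₂, s₂)`. -/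
def letterLaw (pQ : Q → ℝ) (P : S₁ → S₂ → ℝ) (p₁ : Q → S₁ → X₁ → ℝ) (p₂ : Q → S₂ → X₂ → ℝ)
    (W : S₁ → X₁ → S₂ → X₂ → Y → ℝ) (ω : Letters Q S₁ S₂ X₁ X₂ Y) : ℝ :=
  pQ ω.q * jointWeight P (p₁ ω.q) (p₂ ω.q) W ω.s₁ ω.x₁ ω.s₂ ω.x₂ ω.y

/-- The information density `log₂ (p(s₁ | s₂) p(y | x₁, s₁, x₂, s₂) / p(y | x₂, s₂, q))`. -/
def density₁ (P : S₁ → S₂ → ℝ) (p₁ : Q → S₁ → X₁ → ℝ)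
    (W : S₁ → X₁ → S₂ → X₂ → Y → ℝ) (ω : Letters Q S₁ S₂ X₁ X₂ Y) : ℝ :=
  Real.logb 2 (P ω.s₁ ω.s₂ * W ω.s₁ ω.x₁ ω.s₂ ω.x₂ ω.y / mix₁ P (p₁ ω.q) W ω.s₂ ω.x₂ ω.y)

/-- The information density `log₂ (p(s₂ | s₁) p(y | x₁, s₁, x₂, s₂) / p(y | x₁, s₁, q))`. -/
def density₂ (P : S₁ → S₂ → ℝ) (p₂ : Q → S₂ → X₂ → ℝ)
    (W : S₁ → X₁ → S₂ → X₂ → Y → ℝ) (ω : Letters Q S₁ S₂ X₁ X₂ Y) : ℝ :=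
  Real.logb 2 (P ω.s₁ ω.s₂ * W ω.s₁ ω.x₁ ω.s₂ ω.x₂ ω.y / mix₂ P (p₂ ω.q) W ω.s₁ ω.x₁ ω.y)

/-- The information density `log₂ (p(s₁, s₂) p(y | x₁, s₁, x₂, s₂) / p(y | q))`. -/
def density₃ (P : S₁ → S₂ → ℝ) (p₁ : Q → S₁ → X₁ → ℝ) (p₂ : Q → S₂ → X₂ → ℝ)
    (W : S₁ → X₁ → S₂ → X₂ → Y → ℝ) (ω : Letters Q S₁ S₂ X₁ X₂ Y) : ℝ :=
  Real.logb 2 (P ω.s₁ ω.s₂ * W ω.s₁ ω.x₁ ω.s₂ ω.x₂ ω.y / mix₃ P (p₁ ω.q) (p₂ ω.q) W ω.y)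

variable {pQ : Q → ℝ} {P : S₁ → S₂ → ℝ} {p₁ : Q → S₁ → X₁ → ℝ} {p₂ : Q → S₂ → X₂ → ℝ}
  {W : S₁ → X₁ → S₂ → X₂ → Y → ℝ}

lemma logb_sub_add_logb {a b c : ℝ} (ha : a ≠ 0) (hb : b ≠ 0) (hc : c ≠ 0) :
    Real.logb 2 a - Real.logb 2 b + Real.logb 2 c = Real.logb 2 (a * c / b) := by
  rw [Real.logb_div (mul_ne_zero ha hc) hb, Real.logb_mul ha hc]
  ring

/-- The mutual information averages `log (p(x₁, s₁ | y, x₂, s₂, q) / p(x₁, s₁ | x₂, s₂, q))`, and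
subtracting the entropy adds the mean of `log p(s₁ | s₂)`. After substituting the product form of
the law, the factors of `q`, of both inputs and of the marginal of `s₂` cancel, leaving `P · W` over
`mix₁`. -/
theorem information_eq₁ (hQ1 : ∑ q, pQ q = 1) (hP : ∀ s₁ s₂, 0 ≤ P s₁ s₂)
    (h₁ : ∀ q s, p₁ q s ∈ stdSimplex ℝ X₁) (h₂ : ∀ q s, p₂ q s ∈ stdSimplex ℝ X₂)
    (hW : ∀ s₁ x₁ s₂ x₂, W s₁ x₁ s₂ x₂ ∈ stdSimplex ℝ Y) :
    condMutualInfo (letterLaw pQ P p₁ p₂ W) (fun ω => (ω.x₁, ω.s₁)) (fun ω => ω.y)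
        (fun ω => (ω.x₂, ω.s₂, ω.q))
      - condEntropy (letterLaw pQ P p₁ p₂ W) (fun ω => ω.s₁) (fun ω => ω.s₂)
    = expect (letterLaw pQ P p₁ p₂ W) (density₁ P p₁ W) := by
  classical
  have s₁ := fun q s => (h₁ q s).2
  have s₂ := fun q s => (h₂ q s).2
  have sW := fun a b c d => (hW a b c d).2
  have L₁ : ∀ a b c d q, law (letterLaw pQ P p₁ p₂ W)
      (fun ω => ((ω.x₁, ω.s₁), ω.x₂, ω.s₂, ω.q)) ((c, a), d, b, q)
        = pQ q * P a b * p₁ q a c * p₂ q b d := by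
    intro a b c d q
    simp [law_eq_sum_ite, Fintype.sum_prod_type, letterLaw, jointWeight, Letters.q,
      Letters.s₁, Letters.s₂, Letters.x₁, Letters.x₂, Letters.y, ite_and, Finset.sum_ite_irrel,
      ← Finset.mul_sum, ← Finset.sum_mul, s₁, s₂, sW, hQ1, mul_assoc]
  have L₂ : ∀ a b c d q y, law (letterLaw pQ P p₁ p₂ W)
      (fun ω => ((ω.x₁, ω.s₁), ω.y, ω.x₂, ω.s₂, ω.q)) ((c, a), y, d, b, q)
        = pQ q * P a b * p₁ q a c * p₂ q b d * W a c b d y := by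
    intro a b c d q y
    simp [law_eq_sum_ite, Fintype.sum_prod_type, letterLaw, jointWeight, Letters.q,
      Letters.s₁, Letters.s₂, Letters.x₁, Letters.x₂, Letters.y, ite_and, Finset.sum_ite_irrel,
      ← Finset.mul_sum, ← Finset.sum_mul, s₁, s₂, sW, hQ1, mul_assoc]
  have L₃ : ∀ b d q, law (letterLaw pQ P p₁ p₂ W)
      (fun ω => (ω.x₂, ω.s₂, ω.q)) (d, b, q) = pQ q * (∑ a, P a b) * p₂ q b d := by
    intro b d q
    simp [law_eq_sum_ite, Fintype.sum_prod_type, letterLaw, jointWeight, Letters.q,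
      Letters.s₁, Letters.s₂, Letters.x₁, Letters.x₂, Letters.y, ite_and, Finset.sum_ite_irrel,
      ← Finset.mul_sum, ← Finset.sum_mul, s₁, s₂, sW, hQ1, mul_assoc]
  have L₄ : ∀ b d q y, law (letterLaw pQ P p₁ p₂ W)
      (fun ω => (ω.y, ω.x₂, ω.s₂, ω.q)) (y, d, b, q) = pQ q * p₂ q b d * mix₁ P (p₁ q) W b d y := by
    intro b d q y
    simp [law_eq_sum_ite, Fintype.sum_prod_type, letterLaw, jointWeight, Letters.q,
      Letters.s₁, Letters.s₂, Letters.x₁, Letters.x₂, Letters.y, ite_and, Finset.sum_ite_irrel,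
      mix₁, Finset.mul_sum]
    exact Finset.sum_congr rfl fun a _ => Finset.sum_congr rfl fun c _ => by ring
  have L₅ : ∀ a b, law (letterLaw pQ P p₁ p₂ W)
      (fun ω => (ω.s₁, ω.s₂)) (a, b) = P a b := by
    intro a b
    simp [law_eq_sum_ite, Fintype.sum_prod_type, letterLaw, jointWeight, Letters.q,
      Letters.s₁, Letters.s₂, Letters.x₁, Letters.x₂, Letters.y, ite_and, Finset.sum_ite_irrel,
      ← Finset.mul_sum, ← Finset.sum_mul, s₁, s₂, sW, hQ1, mul_assoc]
  have L₆ : ∀ b, law (letterLaw pQ P p₁ p₂ W)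
      (fun ω => ω.s₂) b = ∑ a, P a b := by
    intro b
    simp [law_eq_sum_ite, Fintype.sum_prod_type, letterLaw, jointWeight, Letters.q,
      Letters.s₁, Letters.s₂, Letters.x₁, Letters.x₂, Letters.y, ite_and, Finset.sum_ite_irrel,
      ← Finset.mul_sum, ← Finset.sum_mul, s₁, s₂, sW, hQ1, mul_assoc]
  simp only [condMutualInfo, condEntropy_eq_sum, L₁, L₂, L₃, L₄, L₅, L₆, expect]
  rw [sub_neg_eq_add, sub_neg_eq_add, neg_add_eq_sub, ← Finset.sum_sub_distrib,
    ← Finset.sum_add_distrib]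
  refine Finset.sum_congr rfl fun ω _ => ?_
  obtain ⟨q, a, b, c, d, y⟩ := ω
  -- Letters of weight zero contribute nothing; elsewhere every factor is nonzero and the logarithms
  -- may be combined.
  by_cases h0 : letterLaw pQ P p₁ p₂ W (q, a, b, c, d, y) = 0
  · simp [h0]
  rw [← mul_sub, ← mul_add]
  congr 1
  simp only [letterLaw, jointWeight, Letters.q, Letters.s₁, Letters.s₂, Letters.x₁, Letters.x₂,
    Letters.y, mul_ne_zero_iff, ne_eq] at h0
  simp only [density₁, Letters.q, Letters.s₁, Letters.s₂, Letters.x₁, Letters.x₂, Letters.y]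
  obtain ⟨hq, ⟨⟨hab, hc⟩, hd⟩, hy⟩ := h0
  have hmix : mix₁ P (p₁ q) W b d y ≠ 0 :=
    mix₁_ne_zero hP (fun s => (h₁ q s).1) (fun _ _ _ _ => (hW _ _ _ _).1) hab hc hy
  have hs : ∑ a, P a b ≠ 0 := sum_ne_zero_of_nonneg (fun a => hP a b) hab
  rw [logb_sub_add_logb]
  · congr 1
    field_simp
  all_goals
    simp only [ne_eq, div_eq_zero_iff, mul_eq_zero, hq, hab, hc, hd, hy, hmix, hs, or_self,
      not_false_eq_true]

theorem information_eq₂ (hQ1 : ∑ q, pQ q = 1) (hP : ∀ s₁ s₂, 0 ≤ P s₁ s₂)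
    (h₁ : ∀ q s, p₁ q s ∈ stdSimplex ℝ X₁) (h₂ : ∀ q s, p₂ q s ∈ stdSimplex ℝ X₂)
    (hW : ∀ s₁ x₁ s₂ x₂, W s₁ x₁ s₂ x₂ ∈ stdSimplex ℝ Y) :
    condMutualInfo (letterLaw pQ P p₁ p₂ W) (fun ω => (ω.x₂, ω.s₂)) (fun ω => ω.y)
        (fun ω => (ω.x₁, ω.s₁, ω.q))
      - condEntropy (letterLaw pQ P p₁ p₂ W) (fun ω => ω.s₂) (fun ω => ω.s₁)
    = expect (letterLaw pQ P p₁ p₂ W) (density₂ P p₂ W) := by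
  classical
  have s₁ := fun q s => (h₁ q s).2
  have s₂ := fun q s => (h₂ q s).2
  have sW := fun a b c d => (hW a b c d).2
  have L₁ : ∀ a b c d q, law (letterLaw pQ P p₁ p₂ W)
      (fun ω => ((ω.x₂, ω.s₂), ω.x₁, ω.s₁, ω.q)) ((d, b), c, a, q)
        = pQ q * P a b * p₁ q a c * p₂ q b d := by
    intro a b c d q
    simp [law_eq_sum_ite, Fintype.sum_prod_type, letterLaw, jointWeight, Letters.q,
      Letters.s₁, Letters.s₂, Letters.x₁, Letters.x₂, Letters.y, ite_and, Finset.sum_ite_irrel,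
      ← Finset.mul_sum, ← Finset.sum_mul, s₁, s₂, sW, hQ1, mul_assoc]
  have L₂ : ∀ a b c d q y, law (letterLaw pQ P p₁ p₂ W)
      (fun ω => ((ω.x₂, ω.s₂), ω.y, ω.x₁, ω.s₁, ω.q)) ((d, b), y, c, a, q)
        = pQ q * P a b * p₁ q a c * p₂ q b d * W a c b d y := by
    intro a b c d q y
    simp [law_eq_sum_ite, Fintype.sum_prod_type, letterLaw, jointWeight, Letters.q,
      Letters.s₁, Letters.s₂, Letters.x₁, Letters.x₂, Letters.y, ite_and, Finset.sum_ite_irrel,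
      ← Finset.mul_sum, ← Finset.sum_mul, s₁, s₂, sW, hQ1, mul_assoc]
  have L₃ : ∀ a c q, law (letterLaw pQ P p₁ p₂ W)
      (fun ω => (ω.x₁, ω.s₁, ω.q)) (c, a, q) = pQ q * (∑ b, P a b) * p₁ q a c := by
    intro a c q
    simp [law_eq_sum_ite, Fintype.sum_prod_type, letterLaw, jointWeight, Letters.q,
      Letters.s₁, Letters.s₂, Letters.x₁, Letters.x₂, Letters.y, ite_and, Finset.sum_ite_irrel,
      ← Finset.mul_sum, ← Finset.sum_mul, s₁, s₂, sW, hQ1, mul_assoc]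
  have L₄ : ∀ a c q y, law (letterLaw pQ P p₁ p₂ W)
      (fun ω => (ω.y, ω.x₁, ω.s₁, ω.q)) (y, c, a, q) = pQ q * p₁ q a c * mix₂ P (p₂ q) W a c y := by
    intro a c q y
    simp [law_eq_sum_ite, Fintype.sum_prod_type, letterLaw, jointWeight, Letters.q,
      Letters.s₁, Letters.s₂, Letters.x₁, Letters.x₂, Letters.y, ite_and, Finset.sum_ite_irrel,
      mix₂, Finset.mul_sum]
    exact Finset.sum_congr rfl fun b _ => Finset.sum_congr rfl fun d _ => by ring
  have L₅ : ∀ a b, law (letterLaw pQ P p₁ p₂ W)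
      (fun ω => (ω.s₂, ω.s₁)) (b, a) = P a b := by
    intro a b
    simp [law_eq_sum_ite, Fintype.sum_prod_type, letterLaw, jointWeight, Letters.q,
      Letters.s₁, Letters.s₂, Letters.x₁, Letters.x₂, Letters.y, ite_and, Finset.sum_ite_irrel,
      ← Finset.mul_sum, ← Finset.sum_mul, s₁, s₂, sW, hQ1, mul_assoc]
  have L₆ : ∀ a, law (letterLaw pQ P p₁ p₂ W)
      (fun ω => ω.s₁) a = ∑ b, P a b := by
    intro a
    simp [law_eq_sum_ite, Fintype.sum_prod_type, letterLaw, jointWeight, Letters.q,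
      Letters.s₁, Letters.s₂, Letters.x₁, Letters.x₂, Letters.y, ite_and, Finset.sum_ite_irrel,
      ← Finset.mul_sum, ← Finset.sum_mul, s₁, s₂, sW, hQ1, mul_assoc]
  simp only [condMutualInfo, condEntropy_eq_sum, L₁, L₂, L₃, L₄, L₅, L₆, expect]
  rw [sub_neg_eq_add, sub_neg_eq_add, neg_add_eq_sub, ← Finset.sum_sub_distrib,
    ← Finset.sum_add_distrib]
  refine Finset.sum_congr rfl fun ω _ => ?_
  obtain ⟨q, a, b, c, d, y⟩ := ω
  by_cases h0 : letterLaw pQ P p₁ p₂ W (q, a, b, c, d, y) = 0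
  · simp [h0]
  rw [← mul_sub, ← mul_add]
  congr 1
  simp only [letterLaw, jointWeight, Letters.q, Letters.s₁, Letters.s₂, Letters.x₁, Letters.x₂,
    Letters.y, mul_ne_zero_iff, ne_eq] at h0
  simp only [density₂, Letters.q, Letters.s₁, Letters.s₂, Letters.x₁, Letters.x₂, Letters.y]
  obtain ⟨hq, ⟨⟨hab, hc⟩, hd⟩, hy⟩ := h0
  have hmix : mix₂ P (p₂ q) W a c y ≠ 0 := mix₂_ne_zero hP (fun s => (h₂ q s).1)
    (fun _ _ _ _ => (hW _ _ _ _).1) hab hd hy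
  have hs : ∑ b, P a b ≠ 0 := sum_ne_zero_of_nonneg (fun b => hP a b) hab
  rw [logb_sub_add_logb]
  · congr 1
    field_simp
  all_goals
    simp only [ne_eq, div_eq_zero_iff, mul_eq_zero, hq, hab, hc, hd, hy, hmix, hs, or_self,
      not_false_eq_true]

/-- The same cancellation with only `q` as conditioning: the entropy term contributes the mean of
`log P` itself, and the denominator becomes the output law given `q`. -/
theorem information_eq₃ (hQ1 : ∑ q, pQ q = 1) (hP : ∀ s₁ s₂, 0 ≤ P s₁ s₂)
    (hP1 : ∑ s₁, ∑ s₂, P s₁ s₂ = 1)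
    (h₁ : ∀ q s, p₁ q s ∈ stdSimplex ℝ X₁) (h₂ : ∀ q s, p₂ q s ∈ stdSimplex ℝ X₂)
    (hW : ∀ s₁ x₁ s₂ x₂, W s₁ x₁ s₂ x₂ ∈ stdSimplex ℝ Y) :
    condMutualInfo (letterLaw pQ P p₁ p₂ W) (fun ω => (ω.x₁, ω.s₁, ω.x₂, ω.s₂)) (fun ω => ω.y)
        (fun ω => ω.q)
      - entropy (letterLaw pQ P p₁ p₂ W) (fun ω => (ω.s₁, ω.s₂))
    = expect (letterLaw pQ P p₁ p₂ W) (density₃ P p₁ p₂ W) := by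
  classical
  have s₁ := fun q s => (h₁ q s).2
  have s₂ := fun q s => (h₂ q s).2
  have sW := fun a b c d => (hW a b c d).2
  have L₁ : ∀ a b c d q, law (letterLaw pQ P p₁ p₂ W)
      (fun ω => ((ω.x₁, ω.s₁, ω.x₂, ω.s₂), ω.q)) ((c, a, d, b), q)
        = pQ q * P a b * p₁ q a c * p₂ q b d := by
    intro a b c d q
    simp [law_eq_sum_ite, Fintype.sum_prod_type, letterLaw, jointWeight, Letters.q,
      Letters.s₁, Letters.s₂, Letters.x₁, Letters.x₂, Letters.y, ite_and, Finset.sum_ite_irrel,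
      ← Finset.mul_sum, ← Finset.sum_mul, s₁, s₂, sW, hQ1, mul_assoc]
  have L₂ : ∀ a b c d q y, law (letterLaw pQ P p₁ p₂ W)
      (fun ω => ((ω.x₁, ω.s₁, ω.x₂, ω.s₂), ω.y, ω.q)) ((c, a, d, b), y, q)
        = pQ q * P a b * p₁ q a c * p₂ q b d * W a c b d y := by
    intro a b c d q y
    simp [law_eq_sum_ite, Fintype.sum_prod_type, letterLaw, jointWeight, Letters.q,
      Letters.s₁, Letters.s₂, Letters.x₁, Letters.x₂, Letters.y, ite_and, Finset.sum_ite_irrel,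
      ← Finset.mul_sum, ← Finset.sum_mul, s₁, s₂, sW, hQ1, mul_assoc]
  have L₃ : ∀ q, law (letterLaw pQ P p₁ p₂ W)
      (fun ω => ω.q) q = pQ q := by
    intro q
    simp [law_eq_sum_ite, Fintype.sum_prod_type, letterLaw, jointWeight, Letters.q,
      Letters.s₁, Letters.s₂, Letters.x₁, Letters.x₂, Letters.y, ite_and, Finset.sum_ite_irrel,
      ← Finset.mul_sum, ← Finset.sum_mul, s₁, s₂, sW, hQ1, hP1, mul_assoc]
  have L₄ : ∀ q y, law (letterLaw pQ P p₁ p₂ W)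
      (fun ω => (ω.y, ω.q)) (y, q) = pQ q * mix₃ P (p₁ q) (p₂ q) W y := by
    intro q y
    simp [law_eq_sum_ite, Fintype.sum_prod_type, letterLaw, jointWeight, Letters.q,
      Letters.s₁, Letters.s₂, Letters.x₁, Letters.x₂, Letters.y, ite_and, Finset.sum_ite_irrel,
      mix₃, Finset.mul_sum]
  have L₅ : ∀ a b, law (letterLaw pQ P p₁ p₂ W)
      (fun ω => (ω.s₁, ω.s₂)) (a, b) = P a b := by
    intro a b
    simp [law_eq_sum_ite, Fintype.sum_prod_type, letterLaw, jointWeight, Letters.q,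
      Letters.s₁, Letters.s₂, Letters.x₁, Letters.x₂, Letters.y, ite_and, Finset.sum_ite_irrel,
      ← Finset.mul_sum, ← Finset.sum_mul, s₁, s₂, sW, hQ1, mul_assoc]
  simp only [condMutualInfo, condEntropy_eq_sum, entropy_eq_sum, L₁, L₂, L₃, L₄, L₅, expect]
  rw [sub_neg_eq_add, sub_neg_eq_add, neg_add_eq_sub, ← Finset.sum_sub_distrib,
    ← Finset.sum_add_distrib]
  refine Finset.sum_congr rfl fun ω _ => ?_
  obtain ⟨q, a, b, c, d, y⟩ := ω
  by_cases h0 : letterLaw pQ P p₁ p₂ W (q, a, b, c, d, y) = 0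
  · simp [h0]
  rw [← mul_sub, ← mul_add]
  congr 1
  simp only [letterLaw, jointWeight, Letters.q, Letters.s₁, Letters.s₂, Letters.x₁, Letters.x₂,
    Letters.y, mul_ne_zero_iff, ne_eq] at h0
  simp only [density₃, Letters.q, Letters.s₁, Letters.s₂, Letters.x₁, Letters.x₂, Letters.y]
  obtain ⟨hq, ⟨⟨hab, hc⟩, hd⟩, hy⟩ := h0
  have hmix : mix₃ P (p₁ q) (p₂ q) W y ≠ 0 :=
    mix₃_ne_zero hP (fun s => (h₁ q s).1) (fun s => (h₂ q s).1)
    (fun _ _ _ _ => (hW _ _ _ _).1) hab hc hd hy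
  rw [logb_sub_add_logb]
  · congr 1
    field_simp
  all_goals
    simp only [ne_eq, div_eq_zero_iff, mul_eq_zero, hq, hab, hc, hd, hy, hmix, or_self,
      not_false_eq_true]

end Letter

/-! ### Auxiliary facts on sums over sequences, averaging and convexity. -/

lemma sum_arrow_prod {ι α β : Type*} [Fintype ι] [DecidableEq ι] [Fintype α] [Fintype β]
    (F : (ι → α × β) → ℝ) :
    ∑ h, F h = ∑ f : ι → α, ∑ g : ι → β, F fun j => (f j, g j) := by
  rw [← (Equiv.arrowProdEquivProdArrow ι (fun _ => α) (fun _ => β)).symm.sum_comp,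
    Fintype.sum_prod_type]
  rfl

lemma sum_sum_prod {ι α β : Type*} [Fintype ι] [DecidableEq ι] [Fintype α] [Fintype β]
    (F : ι → α → β → ℝ) :
    ∑ f : ι → α, ∑ g : ι → β, ∏ j, F j (f j) (g j) = ∏ j, ∑ a, ∑ b, F j a b := by
  simp only [Fintype.prod_sum]

lemma rpow_mul_prod_lt_prod {ι : Type*} [Fintype ι] {a b : ι → ℝ} (ha : ∀ j, 0 < a j)
    (hb : ∀ j, 0 < b j) {T : ℝ} (hT : T < ∑ j, Real.logb 2 (a j / b j)) :
    (2 : ℝ) ^ T * ∏ j, b j < ∏ j, a j := by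
  have h : (2 : ℝ) ^ ∑ j, Real.logb 2 (a j / b j) = (∏ j, a j) / ∏ j, b j := by
    rw [Real.rpow_sum_of_pos two_pos, ← Finset.prod_div_distrib]
    refine Finset.prod_congr rfl fun j _ => ?_
    exact Real.rpow_logb two_pos (by norm_num) (div_pos (ha j) (hb j))
  rw [← lt_div_iff₀ (Finset.prod_pos fun j _ => hb j), ← h]
  exact Real.rpow_lt_rpow_of_exponent_lt one_lt_two hT

lemma exists_le_of_sum_mul_le {K : Type*} [Fintype K] {ν F : K → ℝ} (h0 : ∀ k, 0 ≤ ν k)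
    (h1 : ∑ k, ν k = 1) {B : ℝ} (h : ∑ k, ν k * F k ≤ B) : ∃ k, F k ≤ B := by
  by_contra! hlt
  have h2 : ∑ k, ν k * (F k - B) ≤ 0 := by
    simp only [mul_sub, Finset.sum_sub_distrib, ← Finset.sum_mul, h1]
    linarith
  have h3 : ∀ k, 0 ≤ ν k * (F k - B) := fun k => mul_nonneg (h0 k) (sub_nonneg.2 (hlt k).le)
  have h4 := (Finset.sum_eq_zero_iff_of_nonneg fun k _ => h3 k).1
    (le_antisymm h2 (Finset.sum_nonneg fun k _ => h3 k))
  have h5 : ∀ k, ν k = 0 := fun k =>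
    (mul_eq_zero.1 (h4 k (Finset.mem_univ k))).resolve_right (sub_pos.2 (hlt k)).ne'
  simp [h5] at h1

lemma nonempty_of_mem_stdSimplex {α : Type*} [Fintype α] {f : α → ℝ} (hf : f ∈ stdSimplex ℝ α) :
    Nonempty α := by
  by_contra he
  rw [not_nonempty_iff] at he
  simpa using hf.2

/-- The difference of the two sides is the variance. This replaces the squared error of an expected
distortion by a quantity linear in the law, which can be averaged over codebooks. -/
lemma sq_expect_sub_le {Ω : Type*} [Fintype Ω] {p : Ω → ℝ} (hp : p ∈ stdSimplex ℝ Ω)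
    (f : Ω → ℝ) (c : ℝ) : (expect p f - c) ^ 2 ≤ expect p fun ω => (f ω - c) ^ 2 := by
  have h : 0 ≤ ∑ ω, p ω * (f ω - expect p f) ^ 2 :=
    Finset.sum_nonneg fun ω _ => mul_nonneg (hp.1 ω) (sq_nonneg _)
  have e : ∑ ω, p ω * (f ω - expect p f) ^ 2
      = (expect p fun ω => (f ω - c) ^ 2) - 2 * (expect p f - c) * (∑ ω, p ω * f ω)
        + ((expect p f) ^ 2 - c ^ 2) * ∑ ω, p ω := by
    simp only [expect, Finset.mul_sum, ← Finset.sum_add_distrib, ← Finset.sum_sub_distrib]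
    exact Finset.sum_congr rfl fun ω _ => by ring
  rw [e, hp.2] at h
  change 0 ≤ _ - 2 * (expect p f - c) * expect p f + _ at h
  nlinarith

set_option linter.unusedSectionVars false

/-! ### Block versions of sources, inputs, channel and mixtures. -/

section Block

variable {Q S₁ S₂ X₁ X₂ Y : Type*}

/-- The joint weight of uniform messages and memoryless hosts. -/
def blockSource (P : S₁ → S₂ → ℝ) {M₁ M₂ n : ℕ} (i₁ : Fin M₁ × (Fin n → S₁))
    (i₂ : Fin M₂ × (Fin n → S₂)) : ℝ :=
  1 / (M₁ : ℝ) * (1 / (M₂ : ℝ)) * ∏ j, P (i₁.2 j) (i₂.2 j)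

/-- The memoryless input kernel, given the time-sharing sequence `q`. -/
def blockInput {S X : Type*} (p : Q → S → X → ℝ) {M n : ℕ} (q : Fin n → Q)
    (i : Fin M × (Fin n → S)) (x : Fin n → X) : ℝ :=
  ∏ j, p (q j) (i.2 j) (x j)

/-- The memoryless channel. -/
def blockChannel (W : S₁ → X₁ → S₂ → X₂ → Y → ℝ) {M₁ M₂ n : ℕ} (i₁ : Fin M₁ × (Fin n → S₁))
    (x₁ : Fin n → X₁) (i₂ : Fin M₂ × (Fin n → S₂)) (x₂ : Fin n → X₂) (y : Fin n → Y) : ℝ :=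
  ∏ j, W (i₁.2 j) (x₁ j) (i₂.2 j) (x₂ j) (y j)

variable [Fintype Q] [Fintype S₁] [Fintype S₂] [Fintype X₁] [Fintype X₂] [Fintype Y]
  {pQ : Q → ℝ} {P : S₁ → S₂ → ℝ} {p₁ : Q → S₁ → X₁ → ℝ} {p₂ : Q → S₂ → X₂ → ℝ}
  {W : S₁ → X₁ → S₂ → X₂ → Y → ℝ} {M₁ M₂ n : ℕ}

lemma prod_mem_stdSimplex {ι α : Type*} [Fintype ι] [DecidableEq ι] [Fintype α] {p : ι → α → ℝ}
    (hp : ∀ i, p i ∈ stdSimplex ℝ α) : (fun f : ι → α => ∏ i, p i (f i)) ∈ stdSimplex ℝ (ι → α) :=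
  ⟨fun _ => Finset.prod_nonneg fun i _ => (hp i).1 _, sum_prodWeight fun i => (hp i).2⟩

lemma sum_blockSource (hP : ∑ a, ∑ b, P a b = 1) (hM₁ : M₁ ≠ 0) (hM₂ : M₂ ≠ 0) :
    ∑ i₁ : Fin M₁ × (Fin n → S₁), ∑ i₂ : Fin M₂ × (Fin n → S₂), blockSource P i₁ i₂ = 1 := by
  have h := sum_sum_prod (ι := Fin n) (fun _ => P)
  simp only [hP, Finset.prod_const_one] at h
  have h₁ : (M₁ : ℝ) ≠ 0 := by exact_mod_cast hM₁
  have h₂ : (M₂ : ℝ) ≠ 0 := by exact_mod_cast hM₂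
  simp only [blockSource, Fintype.sum_prod_type, ← Finset.mul_sum, Finset.sum_const,
    Finset.card_univ, Fintype.card_fin, nsmul_eq_mul, h]
  field_simp

/-- Summing out the first message cancels its `1 / M₁`. The block source keeps that factor, so the
test ratio is the product of the letter ratios divided by `M₁`; this is how the rate enters. -/
lemma mix₁_block (hM₁ : M₁ ≠ 0) (q : Fin n → Q) (i₂ : Fin M₂ × (Fin n → S₂)) (x₂ : Fin n → X₂)
    (y : Fin n → Y) :
    mix₁ (blockSource (M₁ := M₁) P) (blockInput p₁ q) (blockChannel W) i₂ x₂ y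
      = 1 / (M₂ : ℝ) * ∏ j, mix₁ P (p₁ (q j)) W (i₂.2 j) (x₂ j) (y j) := by
  have h₁ : (M₁ : ℝ) ≠ 0 := by exact_mod_cast hM₁
  simp only [mix₁, ← sum_sum_prod]
  simp only [blockSource, blockInput, blockChannel, Fintype.sum_prod_type, mul_assoc,
    ← Finset.mul_sum, ← Finset.prod_mul_distrib, Finset.sum_const,
    Finset.card_univ, Fintype.card_fin, nsmul_eq_mul]
  field_simp

lemma mix₂_block (hM₂ : M₂ ≠ 0) (q : Fin n → Q) (i₁ : Fin M₁ × (Fin n → S₁)) (x₁ : Fin n → X₁)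
    (y : Fin n → Y) :
    mix₂ (blockSource (M₂ := M₂) P) (blockInput p₂ q) (blockChannel W) i₁ x₁ y
      = 1 / (M₁ : ℝ) * ∏ j, mix₂ P (p₂ (q j)) W (i₁.2 j) (x₁ j) (y j) := by
  have h₂ : (M₂ : ℝ) ≠ 0 := by exact_mod_cast hM₂
  simp only [mix₂, ← sum_sum_prod]
  simp only [blockSource, blockInput, blockChannel, Fintype.sum_prod_type, mul_assoc,
    ← Finset.mul_sum, ← Finset.prod_mul_distrib, Finset.sum_const,
    Finset.card_univ, Fintype.card_fin, nsmul_eq_mul]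
  field_simp

lemma mix₃_block (hM₁ : M₁ ≠ 0) (hM₂ : M₂ ≠ 0) (q : Fin n → Q) (y : Fin n → Y) :
    mix₃ (blockSource (M₁ := M₁) (M₂ := M₂) P) (blockInput p₁ q) (blockInput p₂ q)
        (blockChannel W) y
      = ∏ j, mix₃ P (p₁ (q j)) (p₂ (q j)) W (y j) := by
  have h₁ : (M₁ : ℝ) ≠ 0 := by exact_mod_cast hM₁
  have h₂ : (M₂ : ℝ) ≠ 0 := by exact_mod_cast hM₂
  simp only [mix₃, jointWeight, Fintype.prod_sum]
  simp only [blockSource, blockInput, blockChannel, Fintype.sum_prod_type, mul_assoc,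
    ← Finset.mul_sum, ← Finset.prod_mul_distrib, Finset.sum_const,
    Finset.card_univ, Fintype.card_fin, nsmul_eq_mul]
  field_simp

/-- Averaged over the time-sharing sequence, the block weight is the i.i.d. law of the letters. -/
lemma sum_block (hM₁ : M₁ ≠ 0) (hM₂ : M₂ ≠ 0)
    (G : (Fin n → Letters Q S₁ S₂ X₁ X₂ Y) → ℝ) :
    ∑ q : Fin n → Q, prodWeight (fun _ => pQ) q *
        ∑ i₁ : Fin M₁ × (Fin n → S₁), ∑ i₂ : Fin M₂ × (Fin n → S₂), ∑ x₁, ∑ x₂, ∑ y,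
          jointWeight (blockSource P) (blockInput p₁ q) (blockInput p₂ q) (blockChannel W)
            i₁ x₁ i₂ x₂ y * G (fun j => (q j, i₁.2 j, i₂.2 j, x₁ j, x₂ j, y j))
      = ∑ ω, prodWeight (fun _ => letterLaw pQ P p₁ p₂ W) ω * G ω := by
  have h₁ : (M₁ : ℝ) ≠ 0 := by exact_mod_cast hM₁
  have h₂ : (M₂ : ℝ) ≠ 0 := by exact_mod_cast hM₂
  simp only [sum_arrow_prod]
  refine Finset.sum_congr rfl fun q _ => ?_
  -- `G` does not see the messages, so summing over them cancels the uniform weights.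
  simp only [prodWeight, letterLaw, jointWeight, blockSource, blockInput, blockChannel,
    Letters.q, Letters.s₁, Letters.s₂, Letters.x₁, Letters.x₂, Letters.y,
    Fintype.sum_prod_type, Finset.prod_mul_distrib, mul_assoc,
    ← Finset.mul_sum, Finset.sum_const, Finset.card_univ, Fintype.card_fin, nsmul_eq_mul]
  field_simp

/-- The average of `f` along a sequence of letters. -/
def average {Ω : Type*} {n : ℕ} (f : Ω → ℝ) (ω : Fin n → Ω) : ℝ := (1 / (n : ℝ)) * ∑ j, f (ω j)

/-- The threshold test is passed when the empirical information densities are large. -/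
lemma accept_of_lt_average (hP : ∀ a b, 0 ≤ P a b)
    (h₁ : ∀ q s x, 0 ≤ p₁ q s x) (h₂ : ∀ q s x, 0 ≤ p₂ q s x)
    (hW : ∀ a c b d y, 0 ≤ W a c b d y) (hn : n ≠ 0) (hM₁ : M₁ ≠ 0) (hM₂ : M₂ ≠ 0)
    {R₁ R₂ ε : ℝ} (hR₁ : (M₁ : ℝ) ≤ 2 * 2 ^ ((n : ℝ) * R₁))
    (hR₂ : (M₂ : ℝ) ≤ 2 * 2 ^ ((n : ℝ) * R₂))
    (hε : 2 ≤ n * ε) {q : Fin n → Q} {i₁ : Fin M₁ × (Fin n → S₁)} {i₂ : Fin M₂ × (Fin n → S₂)}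
    {x₁ : Fin n → X₁} {x₂ : Fin n → X₂} {y : Fin n → Y}
    (hω : prodWeight (fun _ => letterLaw pQ P p₁ p₂ W)
      (fun j => (q j, i₁.2 j, i₂.2 j, x₁ j, x₂ j, y j)) ≠ 0)
    (e₁ : R₁ + 2 * ε < average (density₁ P p₁ W) fun j => (q j, i₁.2 j, i₂.2 j, x₁ j, x₂ j, y j))
    (e₂ : R₂ + 2 * ε < average (density₂ P p₂ W) fun j => (q j, i₁.2 j, i₂.2 j, x₁ j, x₂ j, y j))
    (e₃ : R₁ + R₂ + 2 * ε
      < average (density₃ P p₁ p₂ W) fun j => (q j, i₁.2 j, i₂.2 j, x₁ j, x₂ j, y j)) :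
    Accept (blockSource P) (blockInput p₁ q) (blockInput p₂ q) (blockChannel W)
      (2 ^ ((n : ℝ) * ε)) i₁ x₁ i₂ x₂ y := by
  have hn' : (0 : ℝ) < n := by exact_mod_cast Nat.pos_of_ne_zero hn
  have hm₁ : (0 : ℝ) < M₁ := by exact_mod_cast Nat.pos_of_ne_zero hM₁
  have hm₂ : (0 : ℝ) < M₂ := by exact_mod_cast Nat.pos_of_ne_zero hM₂
  have hpos : ∀ j, P (i₁.2 j) (i₂.2 j) ≠ 0 ∧ p₁ (q j) (i₁.2 j) (x₁ j) ≠ 0 ∧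
      p₂ (q j) (i₂.2 j) (x₂ j) ≠ 0 ∧ W (i₁.2 j) (x₁ j) (i₂.2 j) (x₂ j) (y j) ≠ 0 := by
    intro j
    have := (Finset.prod_ne_zero_iff.1 hω) j (Finset.mem_univ j)
    simp only [letterLaw, jointWeight, Letters.q, Letters.s₁, Letters.s₂, Letters.x₁, Letters.x₂,
      Letters.y, mul_ne_zero_iff] at this
    tauto
  have hnum : ∀ j, 0 < P (i₁.2 j) (i₂.2 j) * W (i₁.2 j) (x₁ j) (i₂.2 j) (x₂ j) (y j) := fun j =>
    mul_pos ((hP _ _).lt_of_ne' (hpos j).1) ((hW _ _ _ _ _).lt_of_ne' (hpos j).2.2.2)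
  have p1 : ∀ j, 0 < mix₁ P (p₁ (q j)) W (i₂.2 j) (x₂ j) (y j) := fun j =>
    lt_of_le_of_ne' (Finset.sum_nonneg fun _ _ => Finset.sum_nonneg fun _ _ =>
        mul_nonneg (mul_nonneg (hP _ _) (h₁ _ _ _)) (hW _ _ _ _ _))
      (mix₁_ne_zero hP (h₁ _) hW (hpos j).1 (hpos j).2.1 (hpos j).2.2.2)
  have p2 : ∀ j, 0 < mix₂ P (p₂ (q j)) W (i₁.2 j) (x₁ j) (y j) := fun j =>
    lt_of_le_of_ne' (Finset.sum_nonneg fun _ _ => Finset.sum_nonneg fun _ _ =>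
        mul_nonneg (mul_nonneg (hP _ _) (h₂ _ _ _)) (hW _ _ _ _ _))
      (mix₂_ne_zero hP (h₂ _) hW (hpos j).1 (hpos j).2.2.1 (hpos j).2.2.2)
  have p3 : ∀ j, 0 < mix₃ P (p₁ (q j)) (p₂ (q j)) W (y j) := fun j =>
    lt_of_le_of_ne' (Finset.sum_nonneg fun _ _ => Finset.sum_nonneg fun _ _ =>
        Finset.sum_nonneg fun _ _ => Finset.sum_nonneg fun _ _ =>
        mul_nonneg (mul_nonneg (mul_nonneg (hP _ _) (h₁ _ _ _)) (h₂ _ _ _)) (hW _ _ _ _ _))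
      (mix₃_ne_zero hP (h₁ _) (h₂ _) hW (hpos j).1 (hpos j).2.1 (hpos j).2.2.1 (hpos j).2.2.2)
  have four : (2 : ℝ) ^ (2 : ℝ) = 2 * 2 := by norm_num
  -- One `nε` pays for the threshold `2 ^ (nε)`. The other is at least `2`, giving a factor `4` that
  -- absorbs the factors `2` in the bounds on `M₁` and `M₂`, even when both occur.
  have scale : ∀ {R s : ℝ}, R + 2 * ε < 1 / (n : ℝ) * s → n * R + n * ε + 2 < s := by
    intro R s h
    rw [one_div, ← div_eq_inv_mul, lt_div_iff₀ hn'] at h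
    nlinarith
  have l1 := rpow_mul_prod_lt_prod hnum p1 (scale e₁)
  have l2 := rpow_mul_prod_lt_prod hnum p2 (scale e₂)
  have l3 := rpow_mul_prod_lt_prod hnum p3 (scale e₃)
  rw [Real.rpow_add two_pos, Real.rpow_add two_pos, four, Finset.prod_mul_distrib] at l1 l2 l3
  rw [mul_add, Real.rpow_add two_pos] at l3
  have B1 := (Finset.prod_pos fun j (_ : j ∈ Finset.univ) => p1 j)
  have B2 := (Finset.prod_pos fun j (_ : j ∈ Finset.univ) => p2 j)
  have B3 := (Finset.prod_pos fun j (_ : j ∈ Finset.univ) => p3 j)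
  have t0 : (0 : ℝ) < 2 ^ ((n : ℝ) * ε) := Real.rpow_pos_of_pos two_pos _
  have r1 : (0 : ℝ) < 2 ^ ((n : ℝ) * R₁) := Real.rpow_pos_of_pos two_pos _
  have r2 : (0 : ℝ) < 2 ^ ((n : ℝ) * R₂) := Real.rpow_pos_of_pos two_pos _
  refine ⟨?_, ?_, ?_⟩
  · rw [mix₁_block hM₁]
    have : 2 ^ ((n : ℝ) * ε) * M₁ * ∏ j, mix₁ P (p₁ (q j)) W (i₂.2 j) (x₂ j) (y j)
        < (∏ j, P (i₁.2 j) (i₂.2 j)) * ∏ j, W (i₁.2 j) (x₁ j) (i₂.2 j) (x₂ j) (y j) := by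
      refine lt_of_le_of_lt ?_ l1
      refine mul_le_mul_of_nonneg_right ?_ B1.le
      nlinarith [mul_le_mul_of_nonneg_left hR₁ t0.le, mul_pos t0 r1]
    unfold blockSource blockChannel
    field_simp
    linarith
  · rw [mix₂_block hM₂]
    have : 2 ^ ((n : ℝ) * ε) * M₂ * ∏ j, mix₂ P (p₂ (q j)) W (i₁.2 j) (x₁ j) (y j)
        < (∏ j, P (i₁.2 j) (i₂.2 j)) * ∏ j, W (i₁.2 j) (x₁ j) (i₂.2 j) (x₂ j) (y j) := by
      refine lt_of_le_of_lt ?_ l2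
      refine mul_le_mul_of_nonneg_right ?_ B2.le
      nlinarith [mul_le_mul_of_nonneg_left hR₂ t0.le, mul_pos t0 r2]
    unfold blockSource blockChannel
    field_simp
    linarith
  · rw [mix₃_block hM₁ hM₂]
    have : 2 ^ ((n : ℝ) * ε) * (M₁ * M₂) * ∏ j, mix₃ P (p₁ (q j)) (p₂ (q j)) W (y j)
        < (∏ j, P (i₁.2 j) (i₂.2 j)) * ∏ j, W (i₁.2 j) (x₁ j) (i₂.2 j) (x₂ j) (y j) := by
      refine lt_of_le_of_lt ?_ l3
      refine mul_le_mul_of_nonneg_right ?_ B3.le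
      have := mul_le_mul hR₁ hR₂ hm₂.le (by positivity)
      nlinarith [mul_le_mul_of_nonneg_left this t0.le]
    unfold blockSource blockChannel
    field_simp
    linarith

end Block

set_option linter.unusedSectionVars false

/-! ### Random coding over blocks and selection of a code. -/

section Coding

variable {Q S₁ S₂ X₁ X₂ Y : Type*} [Fintype Q] [Fintype S₁] [Fintype S₂] [Fintype X₁] [Fintype X₂]
  [Fintype Y]
  {pQ : Q → ℝ} {P : S₁ → S₂ → ℝ} {p₁ : Q → S₁ → X₁ → ℝ} {p₂ : Q → S₂ → X₂ → ℝ}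
  {W : S₁ → X₁ → S₂ → X₂ → Y → ℝ} {M₁ M₂ n : ℕ}

lemma sum_letterLaw (hQ1 : ∑ q, pQ q = 1) (hP1 : ∑ a, ∑ b, P a b = 1)
    (h₁ : ∀ q s, ∑ x, p₁ q s x = 1) (h₂ : ∀ q s, ∑ x, p₂ q s x = 1)
    (hW : ∀ a c b d, ∑ y, W a c b d y = 1) : ∑ ω, letterLaw pQ P p₁ p₂ W ω = 1 := by
  simp [letterLaw, jointWeight, Fintype.sum_prod_type, Letters.q, Letters.s₁, Letters.s₂,
    Letters.x₁, Letters.x₂, Letters.y, ← Finset.mul_sum, hW, h₁, h₂, hP1, hQ1, mul_assoc]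

/-- The mean square deviation of `f` under the law `p`. -/
def deviation {Ω : Type*} [Fintype Ω] (p : Ω → ℝ) (f : Ω → ℝ) : ℝ :=
  expect p fun ω => (f ω - expect p f) ^ 2

/-- Serves to transfer nonvanishing from the block weight to the product of the letter weights. -/
lemma prodWeight_letterLaw (hM₁ : M₁ ≠ 0) (hM₂ : M₂ ≠ 0) (q : Fin n → Q)
    (i₁ : Fin M₁ × (Fin n → S₁)) (i₂ : Fin M₂ × (Fin n → S₂)) (x₁ : Fin n → X₁) (x₂ : Fin n → X₂)
    (y : Fin n → Y) :
    prodWeight (fun _ => letterLaw pQ P p₁ p₂ W) (fun j => (q j, i₁.2 j, i₂.2 j, x₁ j, x₂ j, y j))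
      = M₁ * M₂ * (prodWeight (fun _ => pQ) q * jointWeight (blockSource P) (blockInput p₁ q)
          (blockInput p₂ q) (blockChannel W) i₁ x₁ i₂ x₂ y) := by
  have h₁ : (M₁ : ℝ) ≠ 0 := by exact_mod_cast hM₁
  have h₂ : (M₂ : ℝ) ≠ 0 := by exact_mod_cast hM₂
  simp only [prodWeight, letterLaw, jointWeight, blockSource, blockInput, blockChannel,
    Letters.q, Letters.s₁, Letters.s₂, Letters.x₁, Letters.x₂, Letters.y, Finset.prod_mul_distrib]
  field_simp

/-- Chebyshev's inequality in pointwise form: on rejection some empirical density is at most its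
rate plus `2ε`, while `Jᵢ` is at least that rate plus `3ε`, so one of the squares is at least `ε ^
2`. -/
lemma ind_not_accept_le (hP : ∀ a b, 0 ≤ P a b)
    (h₁ : ∀ q s x, 0 ≤ p₁ q s x) (h₂ : ∀ q s x, 0 ≤ p₂ q s x)
    (hW : ∀ a c b d y, 0 ≤ W a c b d y) (hn : n ≠ 0) (hM₁ : M₁ ≠ 0) (hM₂ : M₂ ≠ 0)
    {R₁ R₂ ε : ℝ} (hε0 : 0 < ε)
    (hR₁ : (M₁ : ℝ) ≤ 2 * 2 ^ ((n : ℝ) * R₁)) (hR₂ : (M₂ : ℝ) ≤ 2 * 2 ^ ((n : ℝ) * R₂))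
    (hε : 2 ≤ n * ε) {J₁ J₂ J₃ : ℝ} (hJ₁ : R₁ + 3 * ε ≤ J₁) (hJ₂ : R₂ + 3 * ε ≤ J₂)
    (hJ₃ : R₁ + R₂ + 3 * ε ≤ J₃)
    (q : Fin n → Q) (i₁ : Fin M₁ × (Fin n → S₁)) (i₂ : Fin M₂ × (Fin n → S₂))
    (x₁ : Fin n → X₁) (x₂ : Fin n → X₂) (y : Fin n → Y)
    (hω : prodWeight (fun _ => letterLaw pQ P p₁ p₂ W)
      (fun j => (q j, i₁.2 j, i₂.2 j, x₁ j, x₂ j, y j)) ≠ 0) :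
    ind (¬Accept (blockSource P) (blockInput p₁ q) (blockInput p₂ q) (blockChannel W)
        (2 ^ ((n : ℝ) * ε)) i₁ x₁ i₂ x₂ y) ≤
      ((average (density₁ P p₁ W) (fun j => (q j, i₁.2 j, i₂.2 j, x₁ j, x₂ j, y j)) - J₁) ^ 2
      + (average (density₂ P p₂ W) (fun j => (q j, i₁.2 j, i₂.2 j, x₁ j, x₂ j, y j)) - J₂) ^ 2
      + (average (density₃ P p₁ p₂ W) (fun j => (q j, i₁.2 j, i₂.2 j, x₁ j, x₂ j, y j)) - J₃) ^ 2)
        / ε ^ 2 := by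
  have dev : ∀ {a J R : ℝ}, R + 3 * ε ≤ J → ¬ R + 2 * ε < a → ε ^ 2 ≤ (a - J) ^ 2 := by
    intro a J R h h'
    nlinarith
  rw [le_div_iff₀ (by positivity)]
  by_cases hA : Accept (blockSource P) (blockInput p₁ q) (blockInput p₂ q) (blockChannel W)
        (2 ^ ((n : ℝ) * ε)) i₁ x₁ i₂ x₂ y
  · rw [ind_false (not_not.2 hA), zero_mul]
    positivity
  rw [ind_true hA, one_mul]
  by_contra! hlt
  have n1 := sq_nonneg
    (average (density₁ P p₁ W) (fun j => (q j, i₁.2 j, i₂.2 j, x₁ j, x₂ j, y j)) - J₁)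
  have n2 := sq_nonneg
    (average (density₂ P p₂ W) (fun j => (q j, i₁.2 j, i₂.2 j, x₁ j, x₂ j, y j)) - J₂)
  have n3 := sq_nonneg
    (average (density₃ P p₁ p₂ W) (fun j => (q j, i₁.2 j, i₂.2 j, x₁ j, x₂ j, y j)) - J₃)
  refine hA (accept_of_lt_average hP h₁ h₂ hW hn hM₁ hM₂ hR₁ hR₂ hε hω ?_ ?_ ?_)
  · by_contra h
    linarith [dev hJ₁ h]
  · by_contra h
    linarith [dev hJ₂ h]
  · by_contra h
    linarith [dev hJ₃ h]

lemma sum_deviation_average {Ω : Type*} [Fintype Ω] {p : Ω → ℝ} (hp : ∑ ω, p ω = 1) (f : Ω → ℝ)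
    (hn : n ≠ 0) :
    ∑ ω : Fin n → Ω, prodWeight (fun _ => p) ω * (average f ω - expect p f) ^ 2
      = deviation p f / n :=
  sum_prodWeight_mul_sq_average hp f hn

/-- Some time-sharing sequence and codebooks do as well as their average. -/
lemma exists_codebooks {I₁ I₂ A₁ A₂ K : Type*} [Fintype I₁] [Fintype I₂] [Fintype A₁] [Fintype A₂]
    [Fintype K] [DecidableEq I₁] [DecidableEq I₂] {ν : K → ℝ} (hν : ν ∈ stdSimplex ℝ K)
    {μ₁ : K → I₁ → A₁ → ℝ} {μ₂ : K → I₂ → A₂ → ℝ} (h₁ : ∀ k i, μ₁ k i ∈ stdSimplex ℝ A₁)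
    (h₂ : ∀ k i, μ₂ k i ∈ stdSimplex ℝ A₂) {F : K → (I₁ → A₁) → (I₂ → A₂) → ℝ} {B : ℝ}
    (h : ∑ k, ν k * ∑ c₁, ∑ c₂, prodWeight (μ₁ k) c₁ * prodWeight (μ₂ k) c₂ * F k c₁ c₂ ≤ B) :
    ∃ k c₁ c₂, F k c₁ c₂ ≤ B := by
  obtain ⟨k, hk⟩ := exists_le_of_sum_mul_le hν.1 hν.2 h
  simp only [mul_assoc, ← Finset.mul_sum] at hk
  obtain ⟨c₁, hc₁⟩ := exists_le_of_sum_mul_le (prodWeight_nonneg fun i => (h₁ k i).1)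
    (sum_prodWeight fun i => (h₁ k i).2) hk
  obtain ⟨c₂, hc₂⟩ := exists_le_of_sum_mul_le (prodWeight_nonneg fun i => (h₂ k i).1)
    (sum_prodWeight fun i => (h₂ k i).2) hc₁
  exact ⟨k, c₁, c₂, hc₂⟩

/-- The block code with given codebooks and the threshold decoder. -/
def codebookCode [Nonempty (Fin M₁ × (Fin n → S₁))] [Nonempty (Fin M₂ × (Fin n → S₂))]
    (P : S₁ → S₂ → ℝ) (p₁ : Q → S₁ → X₁ → ℝ) (p₂ : Q → S₂ → X₂ → ℝ)
    (W : S₁ → X₁ → S₂ → X₂ → Y → ℝ) (t : ℝ) (q : Fin n → Q)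
    (c₁ : Fin M₁ × (Fin n → S₁) → Fin n → X₁) (c₂ : Fin M₂ × (Fin n → S₂) → Fin n → X₂) :
    Code S₁ S₂ X₁ X₂ Y M₁ M₂ n where
  f₁ w s := c₁ (w, s)
  f₂ w s := c₂ (w, s)
  g y :=
    let i := thresholdDecoder (blockSource P) (blockInput p₁ q) (blockInput p₂ q) (blockChannel W)
      t c₁ c₂ y
    (i.1.1, i.1.2, i.2.1, i.2.2)

/-- The host law of a model, in curried form. -/
def Model.source (m : Model S₁ S₂ X₁ X₂ Y) (a : S₁) (b : S₂) : ℝ := m.host (a, b)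

/-- The channel of a model, with each host letter next to its input letter. -/
def Model.transition (m : Model S₁ S₂ X₁ X₂ Y) (a : S₁) (c : X₁) (b : S₂) (d : X₂) : Y → ℝ :=
  m.channel c a d b

lemma Model.source_nonneg (m : Model S₁ S₂ X₁ X₂ Y) (a : S₁) (b : S₂) : 0 ≤ m.source a b :=
  m.host_mem.1 _

lemma Model.sum_source (m : Model S₁ S₂ X₁ X₂ Y) : ∑ a, ∑ b, m.source a b = 1 := by
  rw [← m.host_mem.2, Fintype.sum_prod_type]
  rfl

lemma Model.transition_mem (m : Model S₁ S₂ X₁ X₂ Y) (a : S₁) (c : X₁) (b : S₂) (d : X₂) :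
    m.transition a c b d ∈ stdSimplex ℝ Y :=
  m.channel_mem _ _ _ _

lemma Code.expect_jointLaw (c : Code S₁ S₂ X₁ X₂ Y M₁ M₂ n) (m : Model S₁ S₂ X₁ X₂ Y)
    (F : Outcome S₁ S₂ Y M₁ M₂ n → ℝ) :
    expect (c.jointLaw m) F = ∑ i₁ : Fin M₁ × (Fin n → S₁), ∑ i₂ : Fin M₂ × (Fin n → S₂), ∑ y,
      blockSource m.source i₁ i₂ *
        blockChannel m.transition i₁ (c.f₁ i₁.1 i₁.2) i₂ (c.f₂ i₂.1 i₂.2) y *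
        F ((i₁.1, i₁.2, i₂.1, i₂.2), y) := by
  simp only [expect, Fintype.sum_prod_type]
  rfl

lemma Code.jointLaw_mem (c : Code S₁ S₂ X₁ X₂ Y M₁ M₂ n) (m : Model S₁ S₂ X₁ X₂ Y)
    (hM₁ : M₁ ≠ 0) (hM₂ : M₂ ≠ 0) :
    c.jointLaw m ∈ stdSimplex ℝ (Outcome S₁ S₂ Y M₁ M₂ n) := by
  constructor
  · rintro ⟨⟨w₁, s₁, w₂, s₂⟩, y⟩
    exact mul_nonneg (mul_nonneg (by positivity) (Finset.prod_nonneg fun _ _ => m.host_mem.1 _))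
      (Finset.prod_nonneg fun _ _ => (m.channel_mem _ _ _ _).1 _)
  · have h := c.expect_jointLaw m fun _ => 1
    have hy : ∀ (i₁ : Fin M₁ × (Fin n → S₁)) x₁ (i₂ : Fin M₂ × (Fin n → S₂)) x₂,
        ∑ y, blockChannel m.transition i₁ x₁ i₂ x₂ y = 1 := fun i₁ x₁ i₂ x₂ =>
      (prod_mem_stdSimplex fun j =>
        m.transition_mem (i₁.2 j) (x₁ j) (i₂.2 j) (x₂ j)).2
    simp only [mul_one, ← Finset.mul_sum, hy, sum_blockSource m.sum_source hM₁ hM₂] at h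
    simpa [expect] using h

/-- Error probability plus squared deviations of the distortions from `δ₁`, `δ₂`. -/
def Code.risk (c : Code S₁ S₂ X₁ X₂ Y M₁ M₂ n) (m : Model S₁ S₂ X₁ X₂ Y) (δ₁ δ₂ : ℝ) : ℝ :=
  c.errorProb m + (c.distortion₁ m - δ₁) ^ 2 + (c.distortion₂ m - δ₂) ^ 2

/-- By `sq_expect_sub_le` the squares move inside the expectation, so the bound is one expectation
under the joint law, in the form handled by `oneShot_error_le` and `sum_codebooks`. -/
lemma codebookCode_risk_le [Nonempty (Fin M₁ × (Fin n → S₁))] [Nonempty (Fin M₂ × (Fin n → S₂))]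
    (m : Model S₁ S₂ X₁ X₂ Y) (hM₁ : M₁ ≠ 0) (hM₂ : M₂ ≠ 0) (t δ₁ δ₂ : ℝ) (q : Fin n → Q)
    (c₁ : Fin M₁ × (Fin n → S₁) → Fin n → X₁) (c₂ : Fin M₂ × (Fin n → S₂) → Fin n → X₂) :
    (codebookCode m.source p₁ p₂ m.transition t q c₁ c₂).risk m δ₁ δ₂ ≤
      ∑ i₁ : Fin M₁ × (Fin n → S₁), ∑ i₂ : Fin M₂ × (Fin n → S₂), ∑ y,
        blockSource m.source i₁ i₂ * blockChannel m.transition i₁ (c₁ i₁) i₂ (c₂ i₂) y *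
        (ind (thresholdDecoder (blockSource m.source) (blockInput p₁ q) (blockInput p₂ q)
            (blockChannel m.transition) t c₁ c₂ y ≠ (i₁, i₂))
          + ((1 / (n : ℝ) * ∑ j, m.d₁ (i₁.2 j) (c₁ i₁ j) - δ₁) ^ 2
            + (1 / (n : ℝ) * ∑ j, m.d₂ (i₂.2 j) (c₂ i₂ j) - δ₂) ^ 2)) := by
  set c := codebookCode m.source p₁ p₂ m.transition t q c₁ c₂ with hc
  have hJ := c.jointLaw_mem m hM₁ hM₂
  have a1 := sq_expect_sub_le hJ
    (fun ω => 1 / (n : ℝ) * ∑ j, m.d₁ (ω.1.2.1 j) (c.f₁ ω.1.1 ω.1.2.1 j)) δ₁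
  have a2 := sq_expect_sub_le hJ
    (fun ω => 1 / (n : ℝ) * ∑ j, m.d₂ (ω.1.2.2.2 j) (c.f₂ ω.1.2.2.1 ω.1.2.2.2 j)) δ₂
  have a0 : c.errorProb m = expect (c.jointLaw m) fun ω => ind (c.g ω.2 ≠ ω.1) := by
    unfold Code.errorProb ind
    congr! 3
  have b1 : c.distortion₁ m = expect (c.jointLaw m)
    fun ω => 1 / (n : ℝ) * ∑ j, m.d₁ (ω.1.2.1 j) (c.f₁ ω.1.1 ω.1.2.1 j) := rfl
  have b2 : c.distortion₂ m = expect (c.jointLaw m)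
    fun ω => 1 / (n : ℝ) * ∑ j, m.d₂ (ω.1.2.2.2 j) (c.f₂ ω.1.2.2.1 ω.1.2.2.2 j) := rfl
  rw [← b1] at a1
  rw [← b2] at a2
  rw [Code.expect_jointLaw] at a1 a2 a0
  have hind : ∀ (i₁ : Fin M₁ × (Fin n → S₁)) (i₂ : Fin M₂ × (Fin n → S₂)) y,
      ind (c.g y ≠ (i₁.1, i₁.2, i₂.1, i₂.2)) =
      ind (thresholdDecoder (blockSource m.source) (blockInput p₁ q) (blockInput p₂ q)
            (blockChannel m.transition) t c₁ c₂ y ≠ (i₁, i₂)) := by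
    intro i₁ i₂ y
    congr 1
    simp only [hc, codebookCode, ne_eq, Prod.ext_iff, and_assoc]
  have hf₁ : ∀ i : Fin M₁ × (Fin n → S₁), c.f₁ i.1 i.2 = c₁ i := fun _ => rfl
  have hf₂ : ∀ i : Fin M₂ × (Fin n → S₂), c.f₂ i.1 i.2 = c₂ i := fun _ => rfl
  clear_value c
  simp only [hind, hf₁, hf₂] at a0 a1 a2
  simp only [mul_add (blockSource _ _ _ * blockChannel _ _ _ _ _ _), Finset.sum_add_distrib]
  rw [Code.risk, a0, add_assoc]
  exact add_le_add le_rfl (add_le_add a1 a2)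

/-- Random coding: a code whose risk is at most the average risk. -/
theorem exists_code_risk_le (m : Model S₁ S₂ X₁ X₂ Y) (hQ : pQ ∈ stdSimplex ℝ Q)
    (h₁ : ∀ q s, p₁ q s ∈ stdSimplex ℝ X₁) (h₂ : ∀ q s, p₂ q s ∈ stdSimplex ℝ X₂)
    (hn : n ≠ 0) (hM₁ : M₁ ≠ 0) (hM₂ : M₂ ≠ 0) {R₁ R₂ ε : ℝ} (hε0 : 0 < ε)
    (hR₁ : (M₁ : ℝ) ≤ 2 * 2 ^ ((n : ℝ) * R₁)) (hR₂ : (M₂ : ℝ) ≤ 2 * 2 ^ ((n : ℝ) * R₂))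
    (hε : 2 ≤ n * ε) {p : Letters Q S₁ S₂ X₁ X₂ Y → ℝ}
    (hp : p = letterLaw pQ m.source p₁ p₂ m.transition)
    (hJ₁ : R₁ + 3 * ε ≤ expect p (density₁ m.source p₁ m.transition))
    (hJ₂ : R₂ + 3 * ε ≤ expect p (density₂ m.source p₂ m.transition))
    (hJ₃ : R₁ + R₂ + 3 * ε ≤ expect p (density₃ m.source p₁ p₂ m.transition)) :
    ∃ c : Code S₁ S₂ X₁ X₂ Y M₁ M₂ n,
      c.risk m (expect p fun ω => m.d₁ ω.s₁ ω.x₁) (expect p fun ω => m.d₂ ω.s₂ ω.x₂) ≤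
        ((deviation p (density₁ m.source p₁ m.transition)
          + deviation p (density₂ m.source p₂ m.transition)
          + deviation p (density₃ m.source p₁ p₂ m.transition)) / ε ^ 2
          + deviation p (fun ω => m.d₁ ω.s₁ ω.x₁) + deviation p (fun ω => m.d₂ ω.s₂ ω.x₂)) / n
        + 3 * (2 ^ ((n : ℝ) * ε))⁻¹ := by
  classical
  have hp1 : ∑ ω, p ω = 1 := by
    rw [hp]
    exact sum_letterLaw hQ.2 m.sum_source (fun q s => (h₁ q s).2) (fun q s => (h₂ q s).2)
      fun a c b d => (m.transition_mem a c b d).2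
  obtain ⟨⟨a₀, b₀⟩⟩ := nonempty_of_mem_stdSimplex m.host_mem
  have hne₁ : Nonempty (Fin M₁ × (Fin n → S₁)) := ⟨(⟨0, Nat.pos_of_ne_zero hM₁⟩, fun _ => a₀)⟩
  have hne₂ : Nonempty (Fin M₂ × (Fin n → S₂)) := ⟨(⟨0, Nat.pos_of_ne_zero hM₂⟩, fun _ => b₀)⟩
  set δ₁ := expect p fun ω => m.d₁ ω.s₁ ω.x₁ with hδ₁
  set δ₂ := expect p fun ω => m.d₂ ω.s₂ ω.x₂ with hδ₂
  set t : ℝ := 2 ^ ((n : ℝ) * ε) with ht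
  have ht0 : 0 < t := Real.rpow_pos_of_pos two_pos _
  have hB₁ : ∀ (q : Fin n → Q) (i : Fin M₁ × (Fin n → S₁)),
      blockInput p₁ q i ∈ stdSimplex ℝ (Fin n → X₁) := fun q i =>
    prod_mem_stdSimplex fun j => h₁ (q j) (i.2 j)
  have hB₂ : ∀ (q : Fin n → Q) (i : Fin M₂ × (Fin n → S₂)),
      blockInput p₂ q i ∈ stdSimplex ℝ (Fin n → X₂) := fun q i =>
    prod_mem_stdSimplex fun j => h₂ (q j) (i.2 j)
  have hBW : ∀ (i₁ : Fin M₁ × (Fin n → S₁)) x₁ (i₂ : Fin M₂ × (Fin n → S₂)) x₂,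
      blockChannel m.transition i₁ x₁ i₂ x₂ ∈ stdSimplex ℝ (Fin n → Y) := fun i₁ x₁ i₂ x₂ =>
    prod_mem_stdSimplex fun j => m.transition_mem (i₁.2 j) (x₁ j) (i₂.2 j) (x₂ j)
  have hBP : ∀ (i₁ : Fin M₁ × (Fin n → S₁)) (i₂ : Fin M₂ × (Fin n → S₂)),
      0 ≤ blockSource m.source i₁ i₂ := fun i₁ i₂ =>
    mul_nonneg (by positivity) (Finset.prod_nonneg fun _ _ => m.source_nonneg _ _)
  have hνQ : prodWeight (fun _ => pQ) ∈ stdSimplex ℝ (Fin n → Q) := prod_mem_stdSimplex fun _ => hQ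
  -- the quantity whose expectation bounds the risk
  set V : (Fin n → Letters Q S₁ S₂ X₁ X₂ Y) → ℝ := fun ω =>
    ((average (density₁ m.source p₁ m.transition) ω
          - expect p (density₁ m.source p₁ m.transition)) ^ 2
      + (average (density₂ m.source p₂ m.transition) ω
          - expect p (density₂ m.source p₂ m.transition)) ^ 2
      + (average (density₃ m.source p₁ p₂ m.transition) ω
          - expect p (density₃ m.source p₁ p₂ m.transition)) ^ 2) / ε ^ 2
      + (average (fun ω => m.d₁ ω.s₁ ω.x₁) ω - δ₁) ^ 2
      + (average (fun ω => m.d₂ ω.s₂ ω.x₂) ω - δ₂) ^ 2 with hV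
  have hVsum : ∑ ω, prodWeight (fun _ => p) ω * V ω
      = ((deviation p (density₁ m.source p₁ m.transition)
          + deviation p (density₂ m.source p₂ m.transition)
          + deviation p (density₃ m.source p₁ p₂ m.transition)) / ε ^ 2
          + deviation p (fun ω => m.d₁ ω.s₁ ω.x₁) + deviation p (fun ω => m.d₂ ω.s₂ ω.x₂)) / n := by
    simp only [hV, mul_add, mul_div_assoc', add_div, Finset.sum_add_distrib, ← Finset.sum_div]
    simp only [sum_deviation_average hp1 _ hn, hδ₁, hδ₂]
    ring
  have perq : ∀ q : Fin n → Q,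
      ∑ c₁, ∑ c₂, prodWeight (blockInput p₁ q) c₁ * prodWeight (blockInput p₂ q) c₂ *
        (codebookCode (M₁ := M₁) (M₂ := M₂) m.source p₁ p₂ m.transition t q c₁ c₂).risk m δ₁ δ₂
      ≤ (∑ i₁ : Fin M₁ × (Fin n → S₁), ∑ i₂ : Fin M₂ × (Fin n → S₂), ∑ x₁, ∑ x₂, ∑ y,
          jointWeight (blockSource m.source) (blockInput p₁ q) (blockInput p₂ q)
            (blockChannel m.transition) i₁ x₁ i₂ x₂ y *
          (ind (¬Accept (blockSource m.source) (blockInput p₁ q) (blockInput p₂ q)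
              (blockChannel m.transition) t i₁ x₁ i₂ x₂ y)
            + ((1 / (n : ℝ) * ∑ j, m.d₁ (i₁.2 j) (x₁ j) - δ₁) ^ 2
            + (1 / (n : ℝ) * ∑ j, m.d₂ (i₂.2 j) (x₂ j) - δ₂) ^ 2))) + 3 * t⁻¹ := by
    intro q
    -- The decoding error is only bounded on average, whereas the distortion terms depend on the
    -- true codewords alone and average exactly.
    have e1 := oneShot_error_le hBP (sum_blockSource m.sum_source hM₁ hM₂) (hB₁ q) (hB₂ q) hBW ht0
    have e2 := sum_codebooks (blockSource m.source) (fun i => (hB₁ q i).2) (fun i => (hB₂ q i).2)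
      (blockChannel (M₁ := M₁) (M₂ := M₂) m.transition) fun i₁ x₁ i₂ x₂ _ =>
        (1 / (n : ℝ) * ∑ j, m.d₁ (i₁.2 j) (x₁ j) - δ₁) ^ 2
            + (1 / (n : ℝ) * ∑ j, m.d₂ (i₂.2 j) (x₂ j) - δ₂) ^ 2
    refine (Finset.sum_le_sum fun c₁ _ => Finset.sum_le_sum fun c₂ _ =>
      mul_le_mul_of_nonneg_left (codebookCode_risk_le m hM₁ hM₂ t δ₁ δ₂ q c₁ c₂)
        (mul_nonneg (prodWeight_nonneg (fun i => (hB₁ q i).1) c₁)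
          (prodWeight_nonneg (fun i => (hB₂ q i).1) c₂))).trans ?_
    simp only [mul_add (blockSource _ _ _ * blockChannel _ _ _ _ _ _),
      mul_add (jointWeight _ _ _ _ _ _ _ _ _), mul_add (prodWeight _ _ * prodWeight _ _),
      Finset.sum_add_distrib] at e1 e2 ⊢
    linarith
  have total : ∑ q : Fin n → Q, prodWeight (fun _ => pQ) q *
      ∑ c₁, ∑ c₂, prodWeight (blockInput p₁ q) c₁ * prodWeight (blockInput p₂ q) c₂ *
        (codebookCode (M₁ := M₁) (M₂ := M₂) m.source p₁ p₂ m.transition t q c₁ c₂).risk m δ₁ δ₂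
      ≤ ∑ ω, prodWeight (fun _ => p) ω * V ω + 3 * t⁻¹ := by
    refine (Finset.sum_le_sum fun q _ => mul_le_mul_of_nonneg_left (perq q) (hνQ.1 q)).trans ?_
    simp only [mul_add (prodWeight (fun _ : Fin n => pQ) _), Finset.sum_add_distrib,
      ← Finset.sum_mul, hνQ.2, one_mul]
    gcongr
    rw [hp, ← sum_block (M₁ := M₁) (M₂ := M₂) hM₁ hM₂]
    refine Finset.sum_le_sum fun q _ => ?_
    simp only [Finset.mul_sum]
    refine Finset.sum_le_sum fun i₁ _ => Finset.sum_le_sum fun i₂ _ =>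
      Finset.sum_le_sum fun x₁ _ => Finset.sum_le_sum fun x₂ _ => Finset.sum_le_sum fun y _ => ?_
    simp only [← mul_assoc]
    have hw0 : 0 ≤ prodWeight (fun _ => pQ) q * jointWeight (blockSource m.source)
        (blockInput p₁ q) (blockInput p₂ q) (blockChannel m.transition) i₁ x₁ i₂ x₂ y :=
      mul_nonneg (hνQ.1 q) (mul_nonneg (mul_nonneg (mul_nonneg (hBP _ _) ((hB₁ q _).1 _))
        ((hB₂ q _).1 _)) ((hBW _ _ _ _).1 _))
    -- The Chebyshev bound is available only on the support of the joint law, where the logarithms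
    -- are meaningful.
    rcases hw0.eq_or_lt with hw | hw
    · rw [← hw, zero_mul, zero_mul]
    refine mul_le_mul_of_nonneg_left ?_ hw0
    have hω : prodWeight (fun _ => letterLaw pQ m.source p₁ p₂ m.transition)
        (fun j => (q j, i₁.2 j, i₂.2 j, x₁ j, x₂ j, y j)) ≠ 0 := by
      rw [prodWeight_letterLaw hM₁ hM₂]
      have h₁ : (M₁ : ℝ) ≠ 0 := by exact_mod_cast hM₁
      have h₂ : (M₂ : ℝ) ≠ 0 := by exact_mod_cast hM₂
      exact mul_ne_zero (mul_ne_zero h₁ h₂) hw.ne'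
    have hle := ind_not_accept_le m.source_nonneg (fun q s => (h₁ q s).1) (fun q s => (h₂ q s).1)
      (fun a c b d => (m.transition_mem a c b d).1) hn hM₁ hM₂ hε0 hR₁ hR₂ hε hJ₁ hJ₂ hJ₃
      q i₁ i₂ x₁ x₂ y hω
    simp only [hV]
    rw [add_assoc]
    refine add_le_add hle (le_of_eq ?_)
    simp only [average, Finset.mul_sum]
    rfl
  rw [hVsum] at total
  obtain ⟨q, c₁, c₂, h⟩ := exists_codebooks hνQ hB₁ hB₂ total
  exact ⟨_, h⟩

end Coding

/-! ### Message set sizes and passage to the limit. -/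

lemma one_le_two_rpow_mul {R : ℝ} (hR : 0 ≤ R) (n : ℕ) : 1 ≤ (2 : ℝ) ^ ((n : ℝ) * R) :=
  Real.one_le_rpow one_le_two (by positivity)

lemma numMessages_ne_zero {R : ℝ} (n : ℕ) : numMessages R n ≠ 0 :=
  (Nat.ceil_pos.2 (Real.rpow_pos_of_pos two_pos _)).ne'

/-- Rounding up adds less than `1`, and `1 ≤ 2 ^ (nR)` because the rate is nonnegative. -/
lemma numMessages_le {R : ℝ} (hR : 0 ≤ R) (n : ℕ) :
    (numMessages R n : ℝ) ≤ 2 * 2 ^ ((n : ℝ) * R) := by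
  have h := Nat.ceil_lt_add_one (Real.rpow_pos_of_pos two_pos ((n : ℝ) * R)).le
  have h1 := one_le_two_rpow_mul hR n
  unfold numMessages
  linarith

lemma tendsto_of_sq_sub_le {D b : ℕ → ℝ} {δ : ℝ} (hb : Tendsto b atTop (𝓝 0))
    (h : ∀ᶠ n in atTop, (D n - δ) ^ 2 ≤ b n) : Tendsto D atTop (𝓝 δ) := by
  have h1 : Tendsto (fun n => (D n - δ) ^ 2) atTop (𝓝 0) :=
    tendsto_of_tendsto_of_tendsto_of_le_of_le' tendsto_const_nhds hb
      (Eventually.of_forall fun n => sq_nonneg _) h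
  have h2 : Tendsto (fun n => |D n - δ|) atTop (𝓝 0) := by
    simpa [Real.sqrt_sq_eq_abs] using h1.sqrt
  have h3 := (tendsto_zero_iff_abs_tendsto_zero _).2 h2
  simpa using h3.add_const δ

theorem innerRegion_subset_achievable {S₁ S₂ X₁ X₂ Y : Type*} [Fintype S₁] [Fintype S₂]
    [Fintype X₁] [Fintype X₂] [Fintype Y] (m : Model S₁ S₂ X₁ X₂ Y) (Δ₁ Δ₂ : ℝ) :
    innerRegion m Δ₁ Δ₂ ⊆ achievable m Δ₁ Δ₂ := by
  rintro ⟨R₁, R₂⟩ ⟨hR₁, hR₂, Q, _, p, ⟨⟨pQ, hQ, p₁, p₂, h₁, h₂, hp⟩, hΔ₁, hΔ₂⟩, I₁, I₂, I₃⟩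
  dsimp only at hR₁ hR₂ I₁ I₂ I₃
  have hp' : p = letterLaw pQ m.source (fun q s => p₁ s q) (fun q s => p₂ s q) m.transition := by
    funext ⟨q, a, b, c, d, y⟩
    rw [hp]
    simp only [letterLaw, jointWeight, Letters.q, Letters.s₁, Letters.s₂, Letters.x₁, Letters.x₂,
      Letters.y, mul_assoc]
    rfl
  have h₁' : ∀ q s, (fun q s => p₁ s q) q s ∈ stdSimplex ℝ X₁ := fun q s => h₁ s q
  have h₂' : ∀ q s, (fun q s => p₂ s q) q s ∈ stdSimplex ℝ X₂ := fun q s => h₂ s q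
  rw [hp', information_eq₁ hQ.2 m.source_nonneg h₁' h₂' m.transition_mem, ← hp'] at I₁
  rw [hp', information_eq₂ hQ.2 m.source_nonneg h₁' h₂' m.transition_mem, ← hp'] at I₂
  rw [hp', information_eq₃ hQ.2 m.source_nonneg m.sum_source h₁' h₂' m.transition_mem,
    ← hp'] at I₃
  obtain ⟨ε, hε0, hJ₁, hJ₂, hJ₃⟩ : ∃ ε : ℝ, 0 < ε ∧
      R₁ + 3 * ε ≤ expect p (density₁ m.source (fun q s => p₁ s q) m.transition) ∧
      R₂ + 3 * ε ≤ expect p (density₂ m.source (fun q s => p₂ s q) m.transition) ∧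
      R₁ + R₂ + 3 * ε ≤ expect p
        (density₃ m.source (fun q s => p₁ s q) (fun q s => p₂ s q) m.transition) := by
    set J₁ := expect p (density₁ m.source (fun q s => p₁ s q) m.transition)
    set J₂ := expect p (density₂ m.source (fun q s => p₂ s q) m.transition)
    set J₃ := expect p
        (density₃ m.source (fun q s => p₁ s q) (fun q s => p₂ s q) m.transition)
    -- A third of the smallest gap in the three strict rate inequalities.
    refine ⟨min (min (J₁ - R₁) (J₂ - R₂)) (J₃ - (R₁ + R₂)) / 3, ?_, ?_, ?_, ?_⟩
    · have : 0 < min (min (J₁ - R₁) (J₂ - R₂)) (J₃ - (R₁ + R₂)) :=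
        lt_min (lt_min (sub_pos.2 I₁) (sub_pos.2 I₂)) (sub_pos.2 I₃)
      positivity
    · linarith [min_le_left (min (J₁ - R₁) (J₂ - R₂)) (J₃ - (R₁ + R₂)),
        min_le_left (J₁ - R₁) (J₂ - R₂)]
    · linarith [min_le_left (min (J₁ - R₁) (J₂ - R₂)) (J₃ - (R₁ + R₂)),
        min_le_right (J₁ - R₁) (J₂ - R₂)]
    · linarith [min_le_right (min (J₁ - R₁) (J₂ - R₂)) (J₃ - (R₁ + R₂))]
  set δ₁ := expect p fun ω => m.d₁ ω.s₁ ω.x₁ with hδ₁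
  set δ₂ := expect p fun ω => m.d₂ ω.s₂ ω.x₂ with hδ₂
  -- `K` is built from single-letter mean square deviations and `ε`, hence does not depend on `n`.
  obtain ⟨K, hK⟩ : ∃ K : ℝ, ∀ n : ℕ, n ≠ 0 → 2 ≤ n * ε →
      ∃ c : Code S₁ S₂ X₁ X₂ Y (numMessages R₁ n) (numMessages R₂ n) n,
        c.risk m δ₁ δ₂ ≤ K / n + 3 * (2 ^ ((n : ℝ) * ε))⁻¹ :=
    ⟨_, fun n hn hnε => exists_code_risk_le m hQ h₁' h₂' hn (numMessages_ne_zero n)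
      (numMessages_ne_zero n) hε0 (numMessages_le hR₁ n) (numMessages_le hR₂ n) hnε hp'
      hJ₁ hJ₂ hJ₃⟩
  have hlim : Tendsto (fun n : ℕ => K / n + 3 * ((2 : ℝ) ^ ((n : ℝ) * ε))⁻¹) atTop (𝓝 0) := by
    have t1 : Tendsto (fun n : ℕ => K / (n : ℝ)) atTop (𝓝 0) :=
      tendsto_const_div_atTop_nhds_zero_nat K
    have t2 : Tendsto (fun n : ℕ => ((2 : ℝ) ^ ((n : ℝ) * ε))⁻¹) atTop (𝓝 0) := by
      refine tendsto_inv_atTop_zero.comp ?_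
      exact (tendsto_rpow_atTop_of_base_gt_one 2 one_lt_two).comp
        (tendsto_natCast_atTop_atTop.atTop_mul_const hε0)
    simpa using t1.add (t2.const_mul 3)
  have hlarge : ∀ᶠ n : ℕ in atTop, n ≠ 0 ∧ 2 ≤ n * ε :=
    (eventually_ne_atTop 0).and
      ((tendsto_natCast_atTop_atTop.atTop_mul_const hε0).eventually_ge_atTop 2)
  have hX : Nonempty (S₁ × S₂) ∧ Nonempty X₁ ∧ Nonempty X₂ := by
    obtain ⟨⟨a₀, b₀⟩⟩ := nonempty_of_mem_stdSimplex m.host_mem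
    obtain ⟨q₀⟩ := nonempty_of_mem_stdSimplex hQ
    exact ⟨⟨(a₀, b₀)⟩, nonempty_of_mem_stdSimplex (h₁ a₀ q₀),
      nonempty_of_mem_stdSimplex (h₂ b₀ q₀)⟩
  obtain ⟨⟨a₀, b₀⟩, ⟨x₁⟩, ⟨x₂⟩⟩ := hX
  have hcode : ∀ n : ℕ, ∃ c : Code S₁ S₂ X₁ X₂ Y (numMessages R₁ n) (numMessages R₂ n) n,
      n ≠ 0 ∧ 2 ≤ n * ε → c.risk m δ₁ δ₂ ≤ K / n + 3 * (2 ^ ((n : ℝ) * ε))⁻¹ := by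
    intro n
    by_cases h : n ≠ 0 ∧ 2 ≤ n * ε
    · obtain ⟨c, hc⟩ := hK n h.1 h.2
      exact ⟨c, fun _ => hc⟩
    -- For the short block lengths any code will do, since they do not affect the limits.
    · exact ⟨⟨fun _ _ _ => x₁, fun _ _ _ => x₂, fun _ =>
        (⟨0, Nat.pos_of_ne_zero (numMessages_ne_zero n)⟩, fun _ => a₀,
          ⟨0, Nat.pos_of_ne_zero (numMessages_ne_zero n)⟩, fun _ => b₀)⟩, fun h' => absurd h' h⟩
  choose c hc using hcode
  have herr : ∀ n, 0 ≤ (c n).errorProb m := fun n =>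
    Finset.sum_nonneg fun ω _ => mul_nonneg
      (((c n).jointLaw_mem m (numMessages_ne_zero n) (numMessages_ne_zero n)).1 ω)
      (by dsimp only; split_ifs <;> norm_num)
  -- The distortions converge to the single-letter expectations themselves. All three summands of
  -- the risk are nonnegative, so each is bounded by the vanishing total.
  refine ⟨hR₁, hR₂, c, ⟨δ₁, hΔ₁, ?_⟩, ⟨δ₂, hΔ₂, ?_⟩, ?_⟩
  · refine tendsto_of_sq_sub_le hlim ?_
    filter_upwards [hlarge] with n hn
    have h := hc n hn
    unfold Code.risk at h
    linarith [herr n, sq_nonneg ((c n).distortion₂ m - δ₂)]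
  · refine tendsto_of_sq_sub_le hlim ?_
    filter_upwards [hlarge] with n hn
    have h := hc n hn
    unfold Code.risk at h
    linarith [herr n, sq_nonneg ((c n).distortion₁ m - δ₁)]
  · refine tendsto_of_tendsto_of_tendsto_of_le_of_le' tendsto_const_nhds hlim
      (Eventually.of_forall herr) ?_
    filter_upwards [hlarge] with n hn
    have h := hc n hn
    unfold Code.risk at h
    linarith [sq_nonneg ((c n).distortion₁ m - δ₁), sq_nonneg ((c n).distortion₂ m - δ₂)]

end MACIE

end

theorem mainTheorem1 {S₁ S₂ X₁ X₂ Y : Type*} [Fintype S₁] [Fintype S₂] [Fintype X₁] [Fintype X₂]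
    [Fintype Y] (m : MACIE.Model S₁ S₂ X₁ X₂ Y) (Δ₁ Δ₂ : ℝ) :
    MACIE.innerRegion m Δ₁ Δ₂ ⊆ MACIE.achievable m Δ₁ Δ₂ ∧
      MACIE.innerRegion m Δ₁ Δ₂ ⊆ MACIE.capacityRegion m Δ₁ Δ₂ :=
  ⟨MACIE.innerRegion_subset_achievable m Δ₁ Δ₂,
    (MACIE.innerRegion_subset_achievable m Δ₁ Δ₂).trans subset_closure⟩
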